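/- For a (complex, not necessarily unital) C*-algebra $B$, let $M(B)$ denote its multiplier algebra and $\mathcal{C}(B) = M(B)/B$ its corona algebra. For a unital C*-algebra $C$, let $\mathcal{U}(C)$ be its unitary group, $\mathcal{U}_0(C)$ the path component of $1$ in $\mathcal{U}(C)$ (norm topology), and $K_1(C) = \varinjlim_n \mathcal{U}(M_n(C))/\mathcal{U}_0(M_n(C))$ along the maps $[u] \mapsto [u \oplus 1]$; $C$ is called $K_1$-injective if the natural map $\mathcal{U}(C)/\mathcal{U}_0(C) \to K_1(C)$ is injective. Write $\mathcal{K}$ for the C*-algebra of compact operators on a separable infinite-dimensional Hilbert space; $B$ is stable if $B \cong B \otimes \mathcal{K}$, and $\sigma$-unital if it has a countable approximate unit. **Lemma.** If $B$ is a $\sigma$-unital stable C*-algebra, then its corona algebra $\mathcal{C}(B)$ is $K_1$-injective; that is, the natural map $\mathcal{U}(\mathcal{C}(B))/\mathcal{U}_0(\mathcal{C}(B)) \to K_1(\mathcal{C}(B))$ is injective. -/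

import Mathlib

open scoped MultiplierAlgebra TensorProduct Topology

noncomputable section

/-! ### Compact operators and stability -/

/-- The adjoint of a compact operator on a Hilbert space is compact. -/
theorem isCompactOperator_star {H : Type*} [NormedAddCommGroup H] [InnerProductSpace ℂ H]
    [CompleteSpace H] {T : H →L[ℂ] H} (hT : IsCompactOperator T) :
    IsCompactOperator (star T : H →L[ℂ] H) := by
  have hTS : IsCompactOperator ((T * star T : H →L[ℂ] H) : H →ₗ[ℂ] H) :=
    hT.comp_clm (star T : H →L[ℂ] H)
  change IsCompactOperator ((star T : H →L[ℂ] H) : H →ₗ[ℂ] H)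
  rw [isCompactOperator_iff_isCompact_closure_image_closedBall _ one_pos]
  refine (TotallyBounded.closure ?_).isCompact_of_isClosed isClosed_closure
  have htb := (hTS.isCompact_closure_image_closedBall 1).totallyBounded.subset subset_closure
  rw [Metric.totallyBounded_iff]
  intro ε hε
  obtain ⟨t, hts, htf, hcov⟩ := Metric.finite_approx_of_totallyBounded htb (ε ^ 2 / 4) (by positivity)
  choose! g hg hgt using fun y (hy : y ∈ t) => hts hy
  refine ⟨(fun y => star T (g y)) '' t, htf.image _, ?_⟩
  rintro _ ⟨x, hx, rfl⟩
  obtain ⟨y, hy, hxy⟩ := Set.mem_iUnion₂.1 (hcov ⟨x, hx, rfl⟩)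
  refine Set.mem_iUnion₂.2 ⟨_, ⟨y, hy, rfl⟩, ?_⟩
  have h1 : ‖T (star T (x - g y))‖ < ε ^ 2 / 4 := by
    have := hgt y hy
    rw [Metric.mem_ball, dist_eq_norm, ← this] at hxy
    simpa using hxy
  have h2 : ‖x - g y‖ ≤ 2 := by
    have h3 := mem_closedBall_zero_iff.1 hx
    have h4 := mem_closedBall_zero_iff.1 (hg y hy)
    linarith [norm_sub_le x (g y)]
  have h5 : ‖star T (x - g y)‖ ^ 2 ≤ ‖T (star T (x - g y))‖ * ‖x - g y‖ := by
    have := ContinuousLinearMap.apply_norm_sq_eq_inner_adjoint_left (star T) (x - g y)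
    rw [← ContinuousLinearMap.star_eq_adjoint, star_star] at this
    rw [this]
    exact (Complex.re_le_norm _).trans (norm_inner_le_norm _ _)
  have h6 : ‖star T (x - g y)‖ < ε := by
    refine lt_of_pow_lt_pow_left₀ 2 hε.le (h5.trans_lt ?_)
    nlinarith [norm_nonneg (x - g y), norm_nonneg (T (star T (x - g y)))]
  rw [Metric.mem_ball, dist_eq_norm]
  simpa using h6

/-- The C⋆-algebra of compact operators on the Hilbert space `H`. -/
def compactOperators (H : Type*) [NormedAddCommGroup H] [InnerProductSpace ℂ H] [CompleteSpace H] :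
    NonUnitalStarSubalgebra ℂ (H →L[ℂ] H) where
  carrier := {T | IsCompactOperator T}
  add_mem' := fun hS hT => hS.add hT
  zero_mem' := isCompactOperator_zero
  mul_mem' := fun {_ T} hS _ => hS.comp_clm T
  smul_mem' := fun c _ hT => hT.smul c
  star_mem' := fun hT => isCompactOperator_star hT

/-- The C⋆-algebra `K` of compact operators on the separable infinite-dimensional Hilbert space
`ℓ²(ℕ)`. -/
abbrev CompactOps : Type := compactOperators (lp (fun _ : ℕ => ℂ) 2)

instance : NonUnitalCStarAlgebra CompactOps :=
  NonUnitalStarSubalgebra.nonUnitalCStarAlgebra (compactOperators (lp (fun _ : ℕ => ℂ) 2))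
    (h_closed := isClosed_setOfPred_isCompactOperator)

/-- The C⋆-algebra `T`, together with the *-homomorphism `j`, is a C⋆-tensor product of `A` and `D`:
it is the completion of the algebraic tensor product `A ⊗[ℂ] D` in a C⋆-norm, namely `x ↦ ‖j x‖`.
If `A` or `D` is nuclear (for instance `D = K`), there is exactly one C⋆-norm on `A ⊗[ℂ] D`, so that
`T` is then the C⋆-tensor product of `A` and `D`. -/
structure IsCStarTensorProduct {A D T : Type*} [NonUnitalCStarAlgebra A] [NonUnitalCStarAlgebra D]
    [NonUnitalCStarAlgebra T] (j : (A ⊗[ℂ] D) →⋆ₙₐ[ℂ] T) : Prop where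
  injective : Function.Injective j
  denseRange : DenseRange j

/-- `B` is stable: `B ≅ B ⊗ K`, that is, `B` is itself a C⋆-tensor product of `B` and `K`. -/
def IsStable (B : Type*) [NonUnitalCStarAlgebra B] : Prop :=
  ∃ j : (B ⊗[ℂ] CompactOps) →⋆ₙₐ[ℂ] B, IsCStarTensorProduct j

/-- `B` is σ-unital: it has a countable approximate unit, that is, an increasing sequence `e` of
positive contractions with `e n * b → b` and `b * e n → b` for all `b`. The positive elements are
those of the form `star x * x`. -/
def IsSigmaUnital (B : Type*) [NonUnitalCStarAlgebra B] : Prop :=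
  ∃ e : ℕ → B, (∀ n, ∃ x, e n = star x * x) ∧ (∀ n, ‖e n‖ ≤ 1) ∧
    (∀ n, ∃ x, e (n + 1) - e n = star x * x) ∧
    ∀ b, Filter.Tendsto (fun n => e n * b) Filter.atTop (𝓝 b) ∧
      Filter.Tendsto (fun n => b * e n) Filter.atTop (𝓝 b)

/-! ### The corona algebra -/

section Corona

variable (B : Type*) [NonUnitalCStarAlgebra B]

/-- The canonical embedding of `B` into its multiplier algebra is injective. -/
theorem coeHom_injective : Function.Injective (DoubleCentralizer.coeHom : B →⋆ₙₐ[ℂ] 𝓜(ℂ, B)) := by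
  intro a b hab
  have h : ∀ x, a * x = b * x := fun x => by
    have := congrArg (fun m : 𝓜(ℂ, B) => m.fst x) hab
    simpa using this
  have := h (star (a - b))
  rw [← sub_eq_zero, ← sub_mul] at this
  exact sub_eq_zero.1 ((CStarRing.mul_star_self_eq_zero_iff _).1 this)

/-- The image of `B` in its multiplier algebra `M(B)`, as an ideal. -/
def multiplierIdeal : Ideal 𝓜(ℂ, B) where
  carrier := Set.range (DoubleCentralizer.coeHom : B →⋆ₙₐ[ℂ] 𝓜(ℂ, B))
  add_mem' := by
    rintro _ _ ⟨a, rfl⟩ ⟨b, rfl⟩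
    exact ⟨a + b, map_add _ a b⟩
  zero_mem' := ⟨0, map_zero _⟩
  smul_mem' := by
    rintro m _ ⟨b, rfl⟩
    refine ⟨m.fst b, ?_⟩
    ext x
    · refine eq_of_sub_eq_zero ((CStarRing.star_mul_self_eq_zero_iff _).1 ?_)
      change star (m.fst b * x - m.fst (b * x)) * (m.fst b * x - m.fst (b * x)) = 0
      rw [mul_sub, ← m.central, ← mul_assoc, ← m.central, mul_assoc, sub_self]
    · simp [m.central]

theorem mem_multiplierIdeal {B : Type*} [NonUnitalCStarAlgebra B] {m : 𝓜(ℂ, B)} :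
    m ∈ multiplierIdeal B ↔ ∃ b : B, (DoubleCentralizer.coeHom b : 𝓜(ℂ, B)) = m := Iff.rfl

theorem star_mem_multiplierIdeal {B : Type*} [NonUnitalCStarAlgebra B] {m : 𝓜(ℂ, B)}
    (hm : m ∈ multiplierIdeal B) : star m ∈ multiplierIdeal B := by
  obtain ⟨b, rfl⟩ := hm
  exact ⟨star b, map_star _ b⟩

instance : (multiplierIdeal B).IsTwoSided where
  mul_mem_of_left {m} n hm := by
    have := (multiplierIdeal B).mul_mem_left (star n) (star_mem_multiplierIdeal hm)
    simpa using star_mem_multiplierIdeal this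

instance : IsClosed (multiplierIdeal B : Set 𝓜(ℂ, B)) :=
  (NonUnitalStarAlgHom.isometry _ (coeHom_injective B)).isClosedEmbedding.isClosed_range

/-- The corona algebra `C(B) = M(B)/B`. -/
abbrev Corona : Type _ := 𝓜(ℂ, B) ⧸ multiplierIdeal B

namespace Corona

variable {B}

/-- The involution of `C(B)`, `(m + B)* = m* + B`. -/
instance : Star (Corona B) where
  star := Quotient.map' star fun a b h => by
    rw [Submodule.quotientRel_def] at h ⊢
    simpa using star_mem_multiplierIdeal h

theorem star_mk (m : 𝓜(ℂ, B)) :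
    star (Ideal.Quotient.mk (multiplierIdeal B) m) = Ideal.Quotient.mk (multiplierIdeal B) (star m) :=
  rfl

instance : StarRing (Corona B) where
  star_involutive x := by
    obtain ⟨m, rfl⟩ := Ideal.Quotient.mk_surjective x
    simp [star_mk]
  star_add x y := by
    obtain ⟨m, rfl⟩ := Ideal.Quotient.mk_surjective x
    obtain ⟨n, rfl⟩ := Ideal.Quotient.mk_surjective y
    simp [star_mk, ← map_add]
  star_mul x y := by
    obtain ⟨m, rfl⟩ := Ideal.Quotient.mk_surjective x
    obtain ⟨n, rfl⟩ := Ideal.Quotient.mk_surjective y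
    simp [star_mk, ← map_mul]

theorem norm_mk_le (m : 𝓜(ℂ, B)) : ‖Ideal.Quotient.mk (multiplierIdeal B) m‖ ≤ ‖m‖ :=
  Submodule.Quotient.norm_mk_le _ m

theorem exists_norm_lt {x : Corona B} {r : ℝ} (h : ‖x‖ < r) :
    ∃ m : 𝓜(ℂ, B), Ideal.Quotient.mk (multiplierIdeal B) m = x ∧ ‖m‖ < r := by
  obtain ⟨m, hm, hlt⟩ := Submodule.Quotient.norm_mk_lt x (sub_pos.2 h)
  exact ⟨m, hm, by linarith⟩

/-- `C(B)` with the quotient ring structure and the quotient norm. -/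
instance : NormedRing (Corona B) where
  __ := Submodule.Quotient.normedAddCommGroup (multiplierIdeal B)
  __ := Ideal.Quotient.ring (multiplierIdeal B)
  norm_mul_le x y := by
    refine le_of_forall_pos_le_add fun ε hε => ?_
    have hlim : Filter.Tendsto (fun δ : ℝ => (‖x‖ + δ) * (‖y‖ + δ)) (𝓝[>] 0)
        (𝓝 (‖x‖ * ‖y‖)) := by
      have : Continuous fun δ : ℝ => (‖x‖ + δ) * (‖y‖ + δ) := by fun_prop
      simpa using (this.tendsto 0).mono_left nhdsWithin_le_nhds
    obtain ⟨δ, hδ, hδ0⟩ := ((hlim.eventually (gt_mem_nhds (lt_add_of_pos_right _ hε))).and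
      self_mem_nhdsWithin).exists
    obtain ⟨m, rfl, hm⟩ := exists_norm_lt (x := x) (lt_add_of_pos_right _ hδ0)
    obtain ⟨n, rfl, hn⟩ := exists_norm_lt (x := y) (lt_add_of_pos_right _ hδ0)
    calc _ ≤ ‖m * n‖ := norm_mk_le (m * n)
      _ ≤ ‖m‖ * ‖n‖ := norm_mul_le m n
      _ ≤ _ := mul_le_mul hm.le hn.le (norm_nonneg _) ((norm_nonneg _).trans hm.le)
      _ ≤ _ := hδ.le

instance : NormedAlgebra ℂ (Corona B) where
  __ := Ideal.Quotient.algebra ℂ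
  norm_smul_le := (Submodule.Quotient.normedSpace (multiplierIdeal B) ℂ).norm_smul_le

instance : StarModule ℂ (Corona B) where
  star_smul c x := by
    obtain ⟨m, rfl⟩ := Ideal.Quotient.mk_surjective x
    change Ideal.Quotient.mk (multiplierIdeal B) (star (c • m)) = _
    rw [star_smul]
    rfl

/-- For `e ∈ B` positive of norm at most one, `‖1 - e‖ ≤ 1` in `M(B)`. -/
theorem norm_one_sub_le {s : B} (hs : ‖star s * s‖ ≤ 1) :
    ‖(1 - DoubleCentralizer.coeHom (star s * s) : 𝓜(ℂ, B))‖ ≤ 1 := by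
  let _ := CStarAlgebra.spectralOrder 𝓜(ℂ, B)
  let _ := CStarAlgebra.spectralOrderedRing 𝓜(ℂ, B)
  set p : 𝓜(ℂ, B) := DoubleCentralizer.coeHom (star s * s) with hp
  have hp0 : 0 ≤ p := by
    rw [hp, map_mul, map_star]
    exact star_mul_self_nonneg _
  have hp1 : p ≤ 1 := by
    rw [← CStarAlgebra.norm_le_one_iff_of_nonneg p hp0, hp,
      NonUnitalStarAlgHom.norm_map _ (coeHom_injective B)]
    exact hs
  rw [CStarAlgebra.norm_le_one_iff_of_nonneg _ (sub_nonneg.2 hp1)]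
  exact sub_le_self _ hp0

instance : CStarRing (Corona B) where
  norm_mul_self_le x := by
    obtain ⟨m, rfl⟩ := Ideal.Quotient.mk_surjective x
    set π := Ideal.Quotient.mk (multiplierIdeal B)
    refine le_of_forall_pos_le_add fun ε hε => ?_
    obtain ⟨n, hn, hlt⟩ := exists_norm_lt (x := star (π m) * π m) (lt_add_of_pos_right _ (half_pos hε))
    have hmem : n - star m * m ∈ multiplierIdeal B := by
      rw [← Ideal.Quotient.eq, hn, map_mul]
      rfl
    obtain ⟨b, hb⟩ := mem_multiplierIdeal.1 hmem
    let _ := CStarAlgebra.spectralOrder B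
    let _ := CStarAlgebra.spectralOrderedRing B
    have hau := CStarAlgebra.increasingApproximateUnit B
    have hten : Filter.Tendsto (fun e => ‖b - b * e‖) (CStarAlgebra.approximateUnit B) (𝓝 0) := by
      have := (tendsto_const_nhds (x := b)).sub (hau.tendsto_mul_left b)
      simpa using this.norm
    obtain ⟨e, ⟨he, he0⟩, he1⟩ := ((hten.eventually (gt_mem_nhds (half_pos hε))).and
      hau.eventually_nonneg |>.and hau.eventually_norm).exists
    obtain ⟨s, rfl⟩ := CStarAlgebra.nonneg_iff_eq_star_mul_self.1 he0
    set q : 𝓜(ℂ, B) := 1 - DoubleCentralizer.coeHom (star s * s) with hq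
    have hq1 : ‖q‖ ≤ 1 := norm_one_sub_le he1
    have hqs : star q = q := by
      rw [hq, star_sub, star_one, ← map_star, star_mul, star_star]
    have hmq : π m = π (m * q) := by
      rw [Ideal.Quotient.eq, hq, mul_sub, mul_one, sub_sub_cancel]
      exact (multiplierIdeal B).mul_mem_left _ ⟨_, rfl⟩
    have hbq : ‖(DoubleCentralizer.coeHom b : 𝓜(ℂ, B)) * q‖ < ε / 2 := by
      rw [hq, mul_sub, mul_one, ← map_mul, ← map_sub,
        NonUnitalStarAlgHom.norm_map _ (coeHom_injective B)]
      exact he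
    calc ‖π m‖ * ‖π m‖ ≤ ‖m * q‖ * ‖m * q‖ := by
          rw [hmq]
          exact mul_self_le_mul_self (norm_nonneg _) (norm_mk_le _)
      _ = ‖star (m * q) * (m * q)‖ := CStarRing.norm_star_mul_self.symm
      _ = ‖q * n * q - q * (DoubleCentralizer.coeHom b * q)‖ := by
          rw [hb, star_mul, hqs]
          congr 1
          noncomm_ring
      _ ≤ ‖q * n * q‖ + ‖q * (DoubleCentralizer.coeHom b * q)‖ := norm_sub_le _ _
      _ ≤ 1 * ‖n‖ * 1 + 1 * ‖(DoubleCentralizer.coeHom b : 𝓜(ℂ, B)) * q‖ := by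
          refine add_le_add ?_ ?_
          · exact (norm_mul_le _ _).trans (mul_le_mul ((norm_mul_le _ _).trans
              (mul_le_mul_of_nonneg_right hq1 (norm_nonneg _))) hq1 (norm_nonneg _) (by positivity))
          · exact (norm_mul_le _ _).trans (mul_le_mul_of_nonneg_right hq1 (norm_nonneg _))
      _ ≤ _ := by linarith

/-- The corona algebra is a unital C⋆-algebra. -/
instance : CStarAlgebra (Corona B) where

end Corona

end Corona

/-! ### The group `K₁` and `K₁`-injectivity -/

section KTheory

/-! `CStarMatrix (Fin n) (Fin n) A` is the C⋆-algebra `M_n(A)`; its norm topology is the entrywise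
topology. -/

variable {A : Type*} [CStarAlgebra A]

instance (n : ℕ) : IsTopologicalRing (CStarMatrix (Fin n) (Fin n) A) :=
  inferInstanceAs (IsTopologicalRing (Matrix (Fin n) (Fin n) A))

instance (n : ℕ) : ContinuousStar (CStarMatrix (Fin n) (Fin n) A) :=
  inferInstanceAs (ContinuousStar (Matrix (Fin n) (Fin n) A))

/-- The block matrix `a ⊕ 1_{m - n}` in `M_m(A)`, for `a` in `M_n(A)` and `n ≤ m`. -/
def oplusOne {n : ℕ} (m : ℕ) (a : CStarMatrix (Fin n) (Fin n) A) : CStarMatrix (Fin m) (Fin m) A :=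
  CStarMatrix.ofMatrix fun i j =>
    if h : (i : ℕ) < n ∧ (j : ℕ) < n then a ⟨i, h.1⟩ ⟨j, h.2⟩ else if i = j then 1 else 0

theorem oplusOne_apply {n : ℕ} (m : ℕ) (a : CStarMatrix (Fin n) (Fin n) A) (i j : Fin m) :
    oplusOne m a i j =
      if h : (i : ℕ) < n ∧ (j : ℕ) < n then a ⟨i, h.1⟩ ⟨j, h.2⟩ else if i = j then 1 else 0 := rfl

theorem oplusOne_one (n m : ℕ) : oplusOne m (1 : CStarMatrix (Fin n) (Fin n) A) = 1 := by
  ext i j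
  by_cases h : (i : ℕ) < n ∧ (j : ℕ) < n
  · simp [oplusOne_apply, h, CStarMatrix.one_apply, Fin.ext_iff]
  · simp [oplusOne_apply, h, CStarMatrix.one_apply]

theorem oplusOne_star {n : ℕ} (m : ℕ) (a : CStarMatrix (Fin n) (Fin n) A) :
    oplusOne m (star a) = star (oplusOne m a) := by
  ext i j
  rw [CStarMatrix.star_apply, oplusOne_apply, oplusOne_apply]
  by_cases h : (i : ℕ) < n ∧ (j : ℕ) < n
  · rw [dif_pos h, dif_pos h.symm, CStarMatrix.star_apply]
  · rw [dif_neg h, dif_neg fun h' => h h'.symm]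
    by_cases hij : i = j
    · simp [hij]
    · rw [if_neg hij, if_neg (Ne.symm hij), star_zero]

theorem oplusOne_mul {n m : ℕ} (h : n ≤ m) (a b : CStarMatrix (Fin n) (Fin n) A) :
    oplusOne m (a * b) = oplusOne m a * oplusOne m b := by
  ext i j
  rw [CStarMatrix.mul_apply]
  by_cases hi : (i : ℕ) < n
  · by_cases hj : (j : ℕ) < n
    · rw [oplusOne_apply, dif_pos ⟨hi, hj⟩, CStarMatrix.mul_apply]
      refine Finset.sum_of_injOn (Fin.castLE h) ((Fin.castLE_injective h).injOn) (by simp) ?_ ?_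
      · intro k _ hk
        have hk' : ¬ (k : ℕ) < n := fun hlt => hk ⟨⟨k, hlt⟩, by simp, rfl⟩
        have hik : i ≠ k := fun e => hk' (e ▸ hi)
        simp [oplusOne_apply, hk', hik]
      · intro k _
        simp [oplusOne_apply, hi, hj]
    · rw [Finset.sum_eq_single j]
      · have hij : i ≠ j := fun e => hj (e ▸ hi)
        simp [oplusOne_apply, hj, hij]
      · intro k _ hk
        simp [oplusOne_apply, hj, hk]
      · simp
  · rw [Finset.sum_eq_single i]
    · simp [oplusOne_apply, hi]
    · intro k _ hk
      simp [oplusOne_apply, hi, hk.symm]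
    · simp

theorem oplusOne_self {n : ℕ} (a : CStarMatrix (Fin n) (Fin n) A) : oplusOne n a = a := by
  ext i j
  simp [oplusOne_apply]

theorem oplusOne_oplusOne {n m k : ℕ} (h : n ≤ m) (a : CStarMatrix (Fin n) (Fin n) A) :
    oplusOne k (oplusOne m a) = oplusOne k a := by
  ext i j
  simp only [oplusOne_apply, Fin.ext_iff]
  grind

theorem continuous_oplusOne (n m : ℕ) :
    Continuous (oplusOne m : CStarMatrix (Fin n) (Fin n) A → CStarMatrix (Fin m) (Fin m) A) := by
  refine continuous_matrix (n := Fin m) (m := Fin m) fun i j => ?_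
  simp only [oplusOne]
  change Continuous fun a : CStarMatrix (Fin n) (Fin n) A =>
    if h : (i : ℕ) < n ∧ (j : ℕ) < n then a ⟨i, h.1⟩ ⟨j, h.2⟩ else if i = j then 1 else 0
  by_cases h : (i : ℕ) < n ∧ (j : ℕ) < n
  · simp only [dif_pos h]
    exact (continuous_id (X := Matrix (Fin n) (Fin n) A)).matrix_elem _ _
  · simp only [dif_neg h]
    exact continuous_const

/-- The group `U(A)/U₀(A)`, where `U₀(A)` is the path component of `1` in the unitary group. -/
abbrev UnitaryComponents (A : Type*) [Ring A] [StarRing A] [TopologicalSpace A]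
    [IsTopologicalRing A] [ContinuousStar A] : Type _ :=
  unitary A ⧸ Subgroup.pathComponentOne (unitary A)

/-- A continuous unital *-preserving multiplicative map induces a homomorphism
`U(A)/U₀(A) → U(A')/U₀(A')`. -/
def UnitaryComponents.map {A A' : Type*} [Ring A] [StarRing A] [TopologicalSpace A]
    [IsTopologicalRing A] [ContinuousStar A] [Ring A'] [StarRing A'] [TopologicalSpace A']
    [IsTopologicalRing A'] [ContinuousStar A'] (f : A →⋆* A') (hf : Continuous f) :
    UnitaryComponents A →* UnitaryComponents A' :=
  QuotientGroup.map _ _ (Unitary.map f : unitary A →* unitary A') fun u hu => by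
    have hc : Continuous (Unitary.map f) := by
      exact Continuous.subtype_mk (hf.comp continuous_subtype_val) _
    have h := Joined.map (f := Unitary.map f) hu hc
    rw [map_one] at h
    exact h

/-- The map `a ↦ a ⊕ 1_{m - n}` from `M_n(A)` to `M_m(A)` (it is not additive). -/
def oplusOneHom {n m : ℕ} (h : n ≤ m) :
    CStarMatrix (Fin n) (Fin n) A →⋆* CStarMatrix (Fin m) (Fin m) A where
  toFun := oplusOne m
  map_one' := oplusOne_one n m
  map_mul' := oplusOne_mul h
  map_star' := oplusOne_star m

variable (A) in
/-- The map `U(M_n(A))/U₀(M_n(A)) → U(M_m(A))/U₀(M_m(A))`, `[u] ↦ [u ⊕ 1_{m - n}]`. -/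
def K1.transition (n m : ℕ) (h : n ≤ m) :
    UnitaryComponents (CStarMatrix (Fin n) (Fin n) A) →*
      UnitaryComponents (CStarMatrix (Fin m) (Fin m) A) :=
  UnitaryComponents.map (oplusOneHom h) (continuous_oplusOne n m)

instance : DirectedSystem (fun n : ℕ => UnitaryComponents (CStarMatrix (Fin n) (Fin n) A))
    (K1.transition A · · ·) where
  map_self n x := by
    induction x using QuotientGroup.induction_on with
    | H u => exact congrArg QuotientGroup.mk (Subtype.ext (oplusOne_self u.1))
  map_map k m n hij hjk x := by
    induction x using QuotientGroup.induction_on with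
    | H u => exact congrArg QuotientGroup.mk (Subtype.ext (oplusOne_oplusOne hij u.1))

/-- The group `K₁(A)` of a unital C⋆-algebra `A`: the direct limit of the groups
`U(M_n(A))/U₀(M_n(A))` along the maps `[u] ↦ [u ⊕ 1]`. -/
abbrev K1 (A : Type*) [CStarAlgebra A] : Type _ :=
  DirectLimit (fun n : ℕ => UnitaryComponents (CStarMatrix (Fin n) (Fin n) A)) (K1.transition A)

/-- The identification of `A` with `M_1(A)`. -/
def oneByOne : A →⋆* CStarMatrix (Fin 1) (Fin 1) A where
  toFun a := CStarMatrix.ofMatrix fun _ _ => a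
  map_one' := by
    ext i j
    obtain rfl := Subsingleton.elim i j
    exact (CStarMatrix.one_apply_eq i).symm
  map_mul' a b := by
    ext i j
    rw [CStarMatrix.mul_apply]
    exact (Fin.sum_univ_one (fun _ : Fin 1 => a * b)).symm
  map_star' _ := rfl

theorem continuous_oneByOne : Continuous (oneByOne : A → CStarMatrix (Fin 1) (Fin 1) A) :=
  continuous_matrix (n := Fin 1) (m := Fin 1) fun _ _ => continuous_id

variable (A) in
/-- The natural map `U(A)/U₀(A) → K₁(A)`. -/
def toK1 : UnitaryComponents A →* K1 A where
  toFun x := ⟦⟨1, UnitaryComponents.map oneByOne continuous_oneByOne x⟩⟧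
  map_one' := by rw [map_one]; exact (DirectLimit.one_def 1).symm
  map_mul' x y := by rw [map_mul]; exact (DirectLimit.mul_def 1 _ _).symm

/-- `A` is `K₁`-injective: the natural map `U(A)/U₀(A) → K₁(A)` is injective. -/
def IsK1Injective (A : Type*) [CStarAlgebra A] : Prop :=
  Function.Injective (toK1 A)

end KTheory

end

/-! The proof has two independent halves.

Algebraic half. Suppose every unitary `u` of a unital C⋆-algebra admits isometries `a`, `b` with
`b⋆a = 0` and `b⋆ua = 0`. For isometries `a`, `b` with orthogonal ranges, the symmetry that
exchanges these ranges through `b a⋆` carries `a` to `b`, and symmetries lie in the component of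
`1`. Moving `ua` to `b` and then `b` to `a` multiplies `u` by elements of that component, so `u` may
be assumed to satisfy `ua = a`. Then `u` acts only on the complement of `p = aa⋆`. A further
symmetry pushes that complement under `p` and identifies `u` with `s u s⋆ + (1 - s s⋆)`, where `s`
is an isometry with range under `p`. If `[u] = 0` in `K₁`, a path from `u ⊕ 1` to `1` in some matrix
algebra is compressed, by isometries with orthogonal ranges, to a path from this element to `1`.
This is `isK1Injective_of_forall_exists`.

Analytic half. Stability gives isometries `S n = 1 ⊗ V n` in `M(B)` with orthogonal ranges and `(S
n)⋆ → 0` strictly on `B`. Let `∑ (x n)⋆ (x n)` be an approximate unit. The sums `a = ∑ S (i (2n)) x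
n` and `b = ∑ S (i (2n+1)) x n` converge strictly to isometries with orthogonal ranges when `i`
grows fast enough. For a given multiplier `m`, the subsequence can also be chosen so that the double
series for `b⋆ma` converges absolutely in norm. Its terms lie in `B`, hence so does `b⋆ma`. With `m`
a lift of `u`, the relation `b⋆ua = 0` holds in the corona. -/

noncomputable section

/-! ### Unitaries and isometries in a unital C⋆-algebra -/

section Swap

variable {A : Type*} [CStarAlgebra A]

/-- A self-adjoint unitary lies in the path component of `1`. -/
theorem mem_pathComponentOne_of_isSelfAdjoint {u : unitary A} (hu : IsSelfAdjoint (u : A)) :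
    u ∈ Subgroup.pathComponentOne (unitary A) := by
  set z : A := (u : A) with hz
  have hzz : z * z = 1 := by
    have := (Unitary.mem_iff.1 u.2).1
    rwa [hu.star_eq] at this
  -- `(1 + z)/2` and `(1 - z)/2` are the spectral projections of `z` for `1` and `-1`; the path
  -- moves the second eigenvalue from `1` to `-1` along the unit circle.
  let f : ℝ → A := fun θ => (1 / 2 : ℂ) • (1 + z) + (Complex.exp (θ * Complex.I) / 2) • (1 - z)
  have hstar (θ : ℝ) : star (f θ) =
      (1 / 2 : ℂ) • (1 + z) + (Complex.exp (-(θ * Complex.I)) / 2) • (1 - z) := by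
    simp only [f, star_add, star_smul, star_sub, star_one, hu.star_eq]
    congr 2
    · simp
    · simp [← Complex.exp_conj]
  have h1 : (1 + z) * (1 + z) = (2 : ℂ) • (1 + z) := by
    simp only [add_mul, mul_add, one_mul, mul_one, hzz, two_smul]; abel
  have h2 : (1 - z) * (1 - z) = (2 : ℂ) • (1 - z) := by
    simp only [sub_mul, mul_sub, one_mul, mul_one, hzz, two_smul]; abel
  have h3 : (1 + z) * (1 - z) = 0 := by
    simp only [add_mul, mul_sub, one_mul, mul_one, hzz]; abel
  have h4 : (1 - z) * (1 + z) = 0 := by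
    simp only [sub_mul, mul_add, one_mul, mul_one, hzz]; abel
  have key (a b : ℂ) (hab : a * b = 1) : ((1 / 2 : ℂ) • (1 + z) + (a / 2) • (1 - z)) *
      ((1 / 2 : ℂ) • (1 + z) + (b / 2) • (1 - z)) = 1 := by
    simp only [add_mul (_ • _), mul_add (_ • _), smul_mul_smul_comm, h1, h2, h3, h4, smul_zero,
      smul_smul]
    have : a / 2 * (b / 2) * 2 = 1 / 2 := by linear_combination hab / 2
    rw [this, show (1 / 2 * (1 / 2) * 2 : ℂ) = 1 / 2 by norm_num, add_zero, zero_add, ← smul_add]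
    have : (1 + z + (1 - z)) = (2 : ℂ) • (1 : A) := by rw [two_smul]; abel
    rw [this, smul_smul]
    norm_num
  have hf (θ : ℝ) : f θ ∈ unitary A := by
    rw [Unitary.mem_iff, hstar]
    exact ⟨key _ _ (by rw [← Complex.exp_add]; simp), key _ _ (by rw [← Complex.exp_add]; simp)⟩
  have hc : Continuous fun θ : ℝ => (⟨f θ, hf θ⟩ : unitary A) := by
    refine Continuous.subtype_mk ?_ _
    fun_prop
  have h := (PathConnectedSpace.joined (0 : ℝ) Real.pi).map hc
  have e0 : (⟨f 0, hf 0⟩ : unitary A) = 1 := by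
    ext
    change (1 / 2 : ℂ) • (1 + z) + (Complex.exp ((0 : ℝ) * Complex.I) / 2) • (1 - z) = 1
    simp only [Complex.ofReal_zero, zero_mul, Complex.exp_zero, ← smul_add]
    have : (1 + z + (1 - z)) = (2 : ℂ) • (1 : A) := by rw [two_smul]; abel
    rw [this, smul_smul]
    norm_num
  have e1 : (⟨f Real.pi, hf Real.pi⟩ : unitary A) = u := by
    ext
    change (1 / 2 : ℂ) • (1 + z) + (Complex.exp (Real.pi * Complex.I) / 2) • (1 - z) = z
    rw [Complex.exp_pi_mul_I, neg_div, neg_smul, ← sub_eq_add_neg, ← smul_sub]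
    have : (1 + z - (1 - z)) = (2 : ℂ) • z := by rw [two_smul]; abel
    rw [this, smul_smul]
    norm_num
  rw [e0, e1] at h
  exact h

/-- The symmetry interchanging the source and the range of a partial isometry `t` with `t * t = 0`. -/
def swap (t : A) : A := t + star t + 1 - star t * t - t * star t

theorem isSelfAdjoint_swap (t : A) : IsSelfAdjoint (swap t) := by
  simp only [IsSelfAdjoint, swap, star_sub, star_add, star_mul, star_star, star_one]
  abel

/-- Since `t² = 0`, the projections `t⋆t` and `tt⋆` are orthogonal. `t + t⋆` exchanges them, and the
remaining terms are the projection onto the complement of both. -/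
theorem swap_mul_swap {t : A} (h : t * (star t * t) = t) (h0 : t * t = 0) :
    swap t * swap t = 1 := by
  have h0' : star t * star t = 0 := by rw [← star_mul, h0, star_zero]
  have h' : star t * (t * star t) = star t := by
    conv_rhs => rw [← h]
    simp [mul_assoc]
  have k0 (x : A) : t * (t * x) = 0 := by rw [← mul_assoc, h0, zero_mul]
  have k0' (x : A) : star t * (star t * x) = 0 := by rw [← mul_assoc, h0', zero_mul]
  simp only [swap, add_mul, sub_mul, mul_add, mul_sub, one_mul, mul_one, mul_assoc, h, h', h0, h0',
    k0, k0', mul_zero]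
  abel

/-- `swap t` as a unitary. -/
def swapUnitary {t : A} (h : t * (star t * t) = t) (h0 : t * t = 0) : unitary A :=
  ⟨swap t, by
    rw [Unitary.mem_iff, (isSelfAdjoint_swap t).star_eq]
    exact ⟨swap_mul_swap h h0, swap_mul_swap h h0⟩⟩

theorem mk_swapUnitary {t : A} (h : t * (star t * t) = t) (h0 : t * t = 0) :
    ((swapUnitary h h0 : unitary A) : UnitaryComponents A) = 1 :=
  (QuotientGroup.eq_one_iff _).2 (mem_pathComponentOne_of_isSelfAdjoint (isSelfAdjoint_swap t))

/-- If `a`, `b` are isometries with `b⋆a = 0`, there is a unitary in the path component of `1`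
that maps `a` to `b`. -/
theorem exists_unitary_mul_eq {a b : A} (ha : star a * a = 1) (hb : star b * b = 1)
    (hab : star b * a = 0) :
    ∃ w : unitary A, (w : UnitaryComponents A) = 1 ∧ (w : A) * a = b := by
  have hba : star a * b = 0 := by
    rw [← star_star (star a * b), star_mul, star_star, hab, star_zero]
  have ea (x : A) : star a * (a * x) = x := by rw [← mul_assoc, ha, one_mul]
  have eb (x : A) : star b * (b * x) = x := by rw [← mul_assoc, hb, one_mul]
  have eab (x : A) : star b * (a * x) = 0 := by rw [← mul_assoc, hab, zero_mul]
  have eba (x : A) : star a * (b * x) = 0 := by rw [← mul_assoc, hba, zero_mul]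
  -- `b a⋆` is a partial isometry with source projection `aa⋆` and range projection `bb⋆`; its
  -- square vanishes because `a⋆b = 0`.
  have h : (b * star a) * (star (b * star a) * (b * star a)) = b * star a := by
    simp only [star_mul, star_star, mul_assoc, ea, eb]
  have h0 : (b * star a) * (b * star a) = 0 := by
    simp only [mul_assoc, eba, mul_zero]
  refine ⟨swapUnitary h h0, mk_swapUnitary h h0, ?_⟩
  change swap (b * star a) * a = b
  simp only [swap, star_mul, star_star, add_mul, sub_mul, mul_assoc, ha, hab, ea, eb,
    mul_one, one_mul, mul_zero]
  abel

end Swap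

/-! ### Corner embeddings of matrix algebras -/

section Compress

variable {A : Type*} [CStarAlgebra A]

/-- For isometries `s i` with orthogonal ranges, the unitary-preserving map
`x ↦ ∑ s i * x i j * (s j)⋆ + (1 - ∑ s i * (s i)⋆)` from `M_n(A)` to `A`. -/
def compress {n : ℕ} (s : Fin n → A) (hs : ∀ i j, star (s i) * s j = if i = j then 1 else 0) :
    CStarMatrix (Fin n) (Fin n) A →⋆* A where
  toFun x := ∑ i, ∑ j, s i * x i j * star (s j) + (1 - ∑ i, s i * star (s i))
  map_one' := by
    have : ∑ i, ∑ j, s i * (1 : CStarMatrix (Fin n) (Fin n) A) i j * star (s j) =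
        ∑ i, s i * star (s i) := by
      refine Finset.sum_congr rfl fun i _ => ?_
      rw [Finset.sum_eq_single i] <;> simp +contextual [eq_comm]
    rw [this]
    abel
  map_mul' x y := by
    have e1 (k : Fin n) : star (s k) * ∑ i, s i * star (s i) = star (s k) := by
      simp [Finset.mul_sum, ← mul_assoc, hs]
    have e2 (k : Fin n) : (∑ i, s i * star (s i)) * s k = s k := by
      simp [Finset.sum_mul, mul_assoc, hs]
    have h1 (z : CStarMatrix (Fin n) (Fin n) A) :
        (∑ i, ∑ j, s i * z i j * star (s j)) * (1 - ∑ i, s i * star (s i)) = 0 := by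
      simp [Finset.sum_mul, mul_assoc, mul_sub, e1]
    have h2 (z : CStarMatrix (Fin n) (Fin n) A) :
        (1 - ∑ i, s i * star (s i)) * (∑ i, ∑ j, s i * z i j * star (s j)) = 0 := by
      simp [Finset.mul_sum, ← mul_assoc, sub_mul, e2]
    have h3 : (1 - ∑ i, s i * star (s i)) * (1 - ∑ i, s i * star (s i)) =
        1 - ∑ i, s i * star (s i) := by
      have : (∑ i, s i * star (s i)) * (1 - ∑ i, s i * star (s i)) = 0 := by
        simp [Finset.sum_mul, mul_assoc, mul_sub, e1]
      rw [sub_mul, this, one_mul, sub_zero]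
    rw [add_mul, mul_add, mul_add, h1, h2, h3, add_zero, zero_add]
    congr 1
    have h4 (i l : Fin n) : s i * (x * y) i l * star (s l) =
        ∑ j, s i * x i j * star (s j) * ∑ k, s k * y k l * star (s l) := by
      rw [CStarMatrix.mul_apply, Finset.mul_sum, Finset.sum_mul]
      refine Finset.sum_congr rfl fun j _ => ?_
      have : star (s j) * ∑ k, s k * y k l * star (s l) = y j l * star (s l) := by
        simp [Finset.mul_sum, ← mul_assoc, hs]
      rw [mul_assoc (s i * x i j), this]
      simp only [mul_assoc]
    simp_rw [h4, Finset.sum_mul]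
    refine Finset.sum_congr rfl fun i _ => ?_
    rw [Finset.sum_comm]
    refine Finset.sum_congr rfl fun j _ => ?_
    rw [← Finset.mul_sum, Finset.sum_comm]
  map_star' x := by
    simp only [star_add, star_sub, star_one, star_sum, star_mul, star_star, CStarMatrix.star_apply]
    rw [Finset.sum_comm]
    simp only [mul_assoc]

theorem continuous_compress {n : ℕ} (s : Fin n → A)
    (hs : ∀ i j, star (s i) * s j = if i = j then 1 else 0) : Continuous (compress s hs) := by
  have h (i j : Fin n) : Continuous fun x : CStarMatrix (Fin n) (Fin n) A => x i j :=
    (continuous_id (X := Matrix (Fin n) (Fin n) A)).matrix_elem i j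
  change Continuous fun x : CStarMatrix (Fin n) (Fin n) A =>
    ∑ i, ∑ j, s i * x i j * star (s j) + (1 - ∑ i, s i * star (s i))
  fun_prop

/-- Each diagonal `1` beyond the first contributes `s i (s i)⋆`, which the complement term of
`compress` absorbs, so only the index `0` survives. -/
theorem compress_oplusOne {n : ℕ} (s : Fin n → A)
    (hs : ∀ i j, star (s i) * s j = if i = j then 1 else 0) (hn : 0 < n) (a : A) :
    compress s hs (oplusOne n (oneByOne a)) =
      s ⟨0, hn⟩ * a * star (s ⟨0, hn⟩) + (1 - s ⟨0, hn⟩ * star (s ⟨0, hn⟩)) := by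
  change ∑ i, ∑ j, s i * oplusOne n (oneByOne a) i j * star (s j) + (1 - ∑ i, s i * star (s i)) = _
  have h (i : Fin n) : ∑ j, s i * oplusOne n (oneByOne a) i j * star (s j) =
      s i * star (s i) + if i = ⟨0, hn⟩ then
        s ⟨0, hn⟩ * a * star (s ⟨0, hn⟩) - s ⟨0, hn⟩ * star (s ⟨0, hn⟩) else 0 := by
    rw [Finset.sum_eq_single i]
    · by_cases hi : i = ⟨0, hn⟩
      · subst hi
        simp only [oplusOne_apply]
        simp
        rfl
      · have : (i : ℕ) ≠ 0 := fun h => hi (Fin.ext h)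
        simp [oplusOne_apply, hi, this]
    · intro j _ hj
      have : ¬ ((i : ℕ) < 1 ∧ (j : ℕ) < 1) := fun h => hj (Fin.ext (by omega))
      rw [oplusOne_apply, dif_neg this, if_neg hj.symm, mul_zero, zero_mul]
    · simp
  simp_rw [h, Finset.sum_add_distrib]
  simp only [Finset.sum_ite_eq', Finset.mem_univ, if_true]
  abel

/-- `s * a * s⋆ + (1 - s * s⋆)` is unitary if `a` is unitary and `s` is an isometry. -/
theorem conj_add_mem_unitary {s : A} (hs : star s * s = 1) (u : unitary A) :
    s * u * star s + (1 - s * star s) ∈ unitary A := by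
  have e (x : A) : star s * (s * x) = x := by rw [← mul_assoc, hs, one_mul]
  have h1 (x : A) : star (u : A) * (u * x) = x := by
    rw [← mul_assoc, (Unitary.mem_iff.1 u.2).1, one_mul]
  have h2 (x : A) : (u : A) * (star (u : A) * x) = x := by
    rw [← mul_assoc, (Unitary.mem_iff.1 u.2).2, one_mul]
  rw [Unitary.mem_iff]
  constructor <;>
  · simp only [star_add, star_sub, star_mul, star_star, star_one, add_mul, sub_mul, mul_add,
      mul_sub, mul_one, one_mul, mul_assoc, e, h1, h2]
    abel

/-- If `[u] = 0` in `K₁(A)`, then `s * u * s⋆ + (1 - s * s⋆)` is in the path component of `1`, when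
`s` is one of two isometries with orthogonal ranges. -/
theorem conj_add_mem_pathComponentOne {s t : A} (hs : star s * s = 1) (ht : star t * t = 1)
    (hst : star s * t = 0) {u : unitary A} (hu : toK1 A (u : UnitaryComponents A) = 1) :
    (((⟨_, conj_add_mem_unitary hs u⟩ : unitary A)) : UnitaryComponents A) = 1 := by
  rw [QuotientGroup.eq_one_iff]
  -- Triviality in the direct limit is already visible at some finite stage `n ≥ 1`.
  obtain ⟨n, hn, _, hnu⟩ : ∃ (n : ℕ) (h1 : 1 ≤ n) (_ : 1 ≤ n), K1.transition A 1 n h1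
      (UnitaryComponents.map oneByOne continuous_oneByOne (u : UnitaryComponents A)) =
        K1.transition A 1 n h1 1 := by
    rw [DirectLimit.one_def 1] at hu
    exact Quotient.exact hu
  rw [map_one] at hnu
  have hw := (QuotientGroup.eq_one_iff _).1 hnu
  have hst' : star t * s = 0 := by
    rw [← star_star (star t * s), star_mul, star_star, hst, star_zero]
  have hpow (k : ℕ) : star (t ^ k) * t ^ k = 1 := by
    induction k with
    | zero => simp
    | succ k ih =>
      rw [pow_succ, star_mul, mul_assoc, ← mul_assoc (star (t ^ k)), ih, one_mul, ht]
  have hlt (i k : ℕ) : star (t ^ i * s) * (t ^ (i + 1 + k) * s) = 0 := by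
    rw [star_mul, add_assoc, pow_add, mul_assoc, mul_assoc (t ^ i), ← mul_assoc (star (t ^ i)),
      hpow, one_mul, add_comm 1 k, pow_succ', mul_assoc, ← mul_assoc, hst, zero_mul]
  -- From two isometries with orthogonal ranges come arbitrarily many: `s, ts, t²s, …`. The one at
  -- index `0` is `s` itself, so compressing `u ⊕ 1` along them gives exactly `s u s⋆ + (1 - s s⋆)`.
  have hS (i j : Fin n) : star (t ^ (i : ℕ) * s) * (t ^ (j : ℕ) * s) = if i = j then 1 else 0 := by
    rcases lt_trichotomy i j with h | h | h
    · obtain ⟨k, hk⟩ := Nat.exists_eq_add_of_lt (Fin.lt_def.1 h)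
      rw [hk, show (i : ℕ) + k + 1 = i + 1 + k by ring, hlt, if_neg h.ne]
    · subst h
      rw [star_mul, mul_assoc, ← mul_assoc (star (t ^ _)), hpow, one_mul, hs, if_pos rfl]
    · obtain ⟨k, hk⟩ := Nat.exists_eq_add_of_lt (Fin.lt_def.1 h)
      rw [if_neg h.ne', ← star_star (star _ * _), star_mul, star_star, hk,
        show (j : ℕ) + k + 1 = j + 1 + k by ring, hlt, star_zero]
  have hc : Continuous (Unitary.map (compress _ hS)) :=
    Continuous.subtype_mk ((continuous_compress _ hS).comp continuous_subtype_val) _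
  have h := Joined.map (f := Unitary.map (compress _ hS)) hw hc
  rw [map_one] at h
  change Joined 1 _
  convert h using 1
  refine Subtype.ext ?_
  change _ = compress _ hS (oplusOne n (oneByOne (u : A)))
  rw [compress_oplusOne _ hS hn]
  simp

/-- A unitary with trivial class in `K₁(A)` that fixes the range of an isometry `a` is in the path
component of `1`, provided that `A` contains two isometries with orthogonal ranges. -/
theorem mk_eq_one_of_mul_eq {a r r' : A} (ha : star a * a = 1) (hr : star r * r = 1)
    (hr' : star r' * r' = 1) (hrr : star r * r' = 0) {u : unitary A} (hua : (u : A) * a = a)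
    (hu : toK1 A (u : UnitaryComponents A) = 1) : (u : UnitaryComponents A) = 1 := by
  have hau : star a * (u : A) = star a := by
    have : star (u : A) * a = a := by
      nth_rw 1 [← hua]
      rw [← mul_assoc, (Unitary.mem_iff.1 u.2).1, one_mul]
    rw [← star_star (star a * (u : A)), star_mul, star_star, this]
  have eaa (x : A) : star a * (a * x) = x := by rw [← mul_assoc, ha, one_mul]
  have err (x : A) : star r * (r * x) = x := by rw [← mul_assoc, hr, one_mul]
  have hs : star (a * r) * (a * r) = 1 := by simp only [star_mul, mul_assoc, eaa, hr]
  have ht : star (a * r') * (a * r') = 1 := by simp only [star_mul, mul_assoc, eaa, hr']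
  have hst : star (a * r) * (a * r') = 0 := by simp only [star_mul, mul_assoc, eaa, hrr]
  have h1 := conj_add_mem_pathComponentOne hs ht hst hu
  have eua (x : A) : (u : A) * (a * x) = a * x := by rw [← mul_assoc, hua]
  have eau (x : A) : star a * ((u : A) * x) = star a * x := by rw [← mul_assoc, hau]
  -- With `p = aa⋆`, the element `ar(1 - p)` is a partial isometry from `1 - p` onto a projection
  -- under `p`, so its square is `0`. Its swap conjugates `u`, which acts only on `1 - p`, into the
  -- corner element of `h1`; `key` states this.
  have hz : (a * r * (1 - a * star a)) * (star (a * r * (1 - a * star a)) *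
      (a * r * (1 - a * star a))) = a * r * (1 - a * star a) := by
    simp only [star_mul, star_sub, star_star, mul_sub, sub_mul, mul_one,
      mul_assoc, eaa, err, hr]
    abel
  have hz0 : (a * r * (1 - a * star a)) * (a * r * (1 - a * star a)) = 0 := by
    simp only [mul_sub, sub_mul, mul_one, mul_assoc, eaa]
    abel
  have key : swapUnitary hz hz0 * u =
      (⟨_, conj_add_mem_unitary hs u⟩ : unitary A) * swapUnitary hz hz0 := by
    ext
    change swap _ * (u : A) = (_ : A) * swap _
    simp only [swap, star_mul, star_sub, star_star, mul_sub, sub_mul, mul_one, one_mul,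
      mul_add, add_mul, mul_assoc, eaa, err, hr, hau, eua]
    abel
  have := congrArg (QuotientGroup.mk : unitary A → UnitaryComponents A) key
  rwa [QuotientGroup.mk_mul, QuotientGroup.mk_mul, mk_swapUnitary, one_mul, mul_one, h1] at this

/-- A criterion for `K₁`-injectivity: for every unitary `u` there are isometries `a`, `b` with
`b⋆a = 0` and `b⋆ua = 0`. -/
theorem isK1Injective_of_forall_exists {A : Type*} [CStarAlgebra A]
    (h : ∀ u : unitary A, ∃ a b : A, star a * a = 1 ∧ star b * b = 1 ∧ star b * a = 0 ∧
      star b * (u * a) = 0) : IsK1Injective A := by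
  refine (injective_iff_map_eq_one _).2 fun x hx => ?_
  induction x using QuotientGroup.induction_on with
  | H u =>
  obtain ⟨a, b, ha, hb, hba, hbua⟩ := h u
  have hab : star a * b = 0 := by
    rw [← star_star (star a * b), star_mul, star_star, hba, star_zero]
  have hua : star ((u : A) * a) * (u * a) = 1 := by
    rw [star_mul, mul_assoc, ← mul_assoc (star (u : A)), (Unitary.mem_iff.1 u.2).1, one_mul, ha]
  -- The ranges of `ua` and `a` need not be orthogonal to each other, so `b`, orthogonal to both,
  -- serves as an intermediate stop.
  obtain ⟨w, hw, hwu⟩ := exists_unitary_mul_eq hua hb hbua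
  obtain ⟨w', hw', hwb⟩ := exists_unitary_mul_eq hb ha hab
  have hcls : ((w' * w * u : unitary A) : UnitaryComponents A) = u := by
    rw [QuotientGroup.mk_mul, QuotientGroup.mk_mul, hw, hw', one_mul, one_mul]
  rw [← hcls] at hx ⊢
  refine mk_eq_one_of_mul_eq ha ha hb hab ?_ hx
  rw [Submonoid.coe_mul, Submonoid.coe_mul, mul_assoc, mul_assoc, hwu, hwb]

end Compress

/-! ### Multipliers of a stable C⋆-algebra -/

/-! ### Compact operators and isometries on `ℓ²(ℕ)` -/

section Operators

/-- Contractions converging strongly to `0` converge to `0` in norm when multiplied with a compact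
operator from the right. -/
theorem tendsto_mul_of_isCompactOperator {H : Type*} [NormedAddCommGroup H]
    [InnerProductSpace ℂ H] {W : ℕ → H →L[ℂ] H} (hW : ∀ n, ‖W n‖ ≤ 1)
    (h0 : ∀ ξ, Filter.Tendsto (fun n => W n ξ) Filter.atTop (𝓝 0)) {T : H →L[ℂ] H}
    (hT : IsCompactOperator T) : Filter.Tendsto (fun n => W n * T) Filter.atTop (𝓝 0) := by
  rw [Metric.tendsto_atTop']
  intro ε hε
  have hTl : IsCompactOperator (T : H →ₗ[ℂ] H) := hT
  have htb := (hTl.isCompact_closure_image_closedBall 1).totallyBounded.subset subset_closure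
  -- Pointwise convergence of contractions is uniform on the totally bounded image of the unit ball;
  -- it is tested on a finite net.
  obtain ⟨t, htf, hcov⟩ := Metric.totallyBounded_iff.1 htb (ε / 4) (by positivity)
  have hev : ∀ᶠ n in Filter.atTop, ∀ y ∈ t, ‖W n y‖ < ε / 4 := by
    rw [Filter.eventually_all_finite htf]
    intro y _
    have := (h0 y).norm
    rw [norm_zero] at this
    exact this.eventually (gt_mem_nhds (by positivity))
  obtain ⟨N, hN⟩ := Filter.eventually_atTop.1 hev
  refine ⟨N, fun n hn => ?_⟩
  rw [dist_zero_right]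
  refine lt_of_le_of_lt (ContinuousLinearMap.opNorm_le_of_unit_norm (C := ε / 2) (by positivity)
    fun x hx => ?_) (half_lt_self hε)
  obtain ⟨y, hy, hxy⟩ := Set.mem_iUnion₂.1 (hcov ⟨x, by simp [hx], rfl⟩)
  rw [Metric.mem_ball, dist_eq_norm] at hxy
  calc ‖W n (T x)‖ = ‖W n (T x - y) + W n y‖ := by rw [map_sub, sub_add_cancel]
    _ ≤ ‖W n (T x - y)‖ + ‖W n y‖ := norm_add_le _ _
    _ ≤ 1 * ‖T x - y‖ + ‖W n y‖ := by gcongr; exact (W n).le_of_opNorm_le (hW n) _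
    _ ≤ ε / 4 + ε / 4 := by
      rw [one_mul]
      exact add_le_add hxy.le (hN n hn.le y hy).le
    _ = ε / 2 := by ring

/-- There is a sequence of isometries of `ℓ²(ℕ)` with orthogonal ranges whose adjoints converge
strongly to `0`. -/
theorem exists_orthogonal_isometries : ∃ V : ℕ → lp (fun _ : ℕ => ℂ) 2 →L[ℂ] lp (fun _ : ℕ => ℂ) 2,
    (∀ m n, star (V m) * V n = if m = n then 1 else 0) ∧
    ∀ ξ, Filter.Tendsto (fun n => star (V n) ξ) Filter.atTop (𝓝 0) := by
  let b : HilbertBasis ℕ ℂ (lp (fun _ : ℕ => ℂ) 2) := HilbertBasis.ofRepr (LinearIsometryEquiv.refl ℂ _)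
  -- `V n` sends the `i`-th basis vector to the one with index `Nat.pair n i`. Thus `(V n)⋆` kills
  -- every basis vector outside the `n`-th block, and any finite combination for large `n`.
  have hb (n : ℕ) : Orthonormal ℂ fun i => b (Nat.pair n i) :=
    b.orthonormal.comp _ fun i k h => (Nat.pair_eq_pair.1 h).2
  let V (n : ℕ) : lp (fun _ : ℕ => ℂ) 2 →ₗᵢ[ℂ] lp (fun _ : ℕ => ℂ) 2 :=
    (hb n).orthogonalFamily.linearIsometry
  have hsum (n : ℕ) (f : lp (fun _ : ℕ => ℂ) 2) :
      HasSum (fun i => f i • b (Nat.pair n i)) (V n f) :=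
    (hb n).orthogonalFamily.hasSum_linearIsometry f
  have hinner (n k : ℕ) (hk : (Nat.unpair k).1 ≠ n) (f : lp (fun _ : ℕ => ℂ) 2) :
      inner ℂ (b k) (V n f) = 0 := by
    have h1 := (hsum n f).mapL (innerSL ℂ (b k))
    refine h1.unique ?_
    convert hasSum_zero with i
    have : k ≠ Nat.pair n i := fun h => hk (by rw [h, Nat.unpair_pair])
    simp [b.orthonormal.2 this]
  have hzero (n k : ℕ) (hk : (Nat.unpair k).1 ≠ n) :
      star (V n).toContinuousLinearMap (b k) = 0 := by
    refine ext_inner_right ℂ fun f => ?_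
    rw [ContinuousLinearMap.star_eq_adjoint, ContinuousLinearMap.adjoint_inner_left, inner_zero_left]
    exact hinner n k hk f
  refine ⟨fun n => (V n).toContinuousLinearMap, fun m n => ?_, fun ξ => ?_⟩
  · split_ifs with h
    · subst h
      exact (ContinuousLinearMap.norm_map_iff_adjoint_comp_self _).1 (V m).norm_map
    · ext1 f
      have h1 := (hsum n f).mapL (star (V m).toContinuousLinearMap)
      refine h1.unique ?_
      convert hasSum_zero with i
      rw [map_smul, hzero m _ (by rw [Nat.unpair_pair]; exact Ne.symm h), smul_zero]
      rfl
  · rw [Metric.tendsto_atTop']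
    intro ε hε
    obtain ⟨s, hs⟩ := (Metric.tendsto_atTop.1 (b.hasSum_repr ξ)) ε hε
    refine ⟨s.sup fun k => (Nat.unpair k).1, fun n hn => ?_⟩
    rw [dist_zero_right]
    have h0 : star (V n).toContinuousLinearMap (∑ k ∈ s, b.repr ξ k • b k) = 0 := by
      rw [map_sum]
      refine Finset.sum_eq_zero fun k hk => ?_
      have : (Nat.unpair k).1 ≤ s.sup fun k => (Nat.unpair k).1 :=
        Finset.le_sup (f := fun k => (Nat.unpair k).1) hk
      rw [map_smul, hzero n k (by omega), smul_zero]
    have h1 : ‖star (V n).toContinuousLinearMap‖ ≤ 1 := by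
      rw [ContinuousLinearMap.star_eq_adjoint, LinearIsometryEquiv.norm_map]
      exact (V n).norm_toContinuousLinearMap_le
    calc ‖star (V n).toContinuousLinearMap ξ‖
        = ‖star (V n).toContinuousLinearMap (ξ - ∑ k ∈ s, b.repr ξ k • b k)‖ := by
          rw [map_sub, h0, sub_zero]
      _ ≤ 1 * ‖ξ - ∑ k ∈ s, b.repr ξ k • b k‖ := ContinuousLinearMap.le_of_opNorm_le _ h1 _
      _ < ε := by
        rw [one_mul, ← dist_eq_norm, dist_comm]
        exact hs s le_rfl

end Operators

/-! ### The operators `1 ⊗ T` on the algebraic tensor product -/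

section Tensor

theorem star_lTensor_mul {A D : Type*} [NonUnitalCStarAlgebra A] [NonUnitalCStarAlgebra D]
    {L L' : D →ₗ[ℂ] D} (h : ∀ k l, star (L k) * l = star k * L' l) (x y : A ⊗[ℂ] D) :
    star (L.lTensor A x) * y = star x * L'.lTensor A y := by
  induction x with
  | zero => rw [map_zero, star_zero, zero_mul, zero_mul]
  | add x x' hx hx' => rw [map_add, star_add, star_add, add_mul, add_mul, hx, hx']
  | tmul b k =>
    induction y with
    | zero => rw [map_zero, mul_zero, mul_zero]
    | add y y' hy hy' => rw [map_add, mul_add, mul_add, hy, hy']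
    | tmul c l =>
      rw [LinearMap.lTensor_tmul, LinearMap.lTensor_tmul, TensorProduct.star_tmul,
        TensorProduct.star_tmul, Algebra.TensorProduct.tmul_mul_tmul,
        Algebra.TensorProduct.tmul_mul_tmul, h]

/-- Positivity of `‖T‖² - T⋆T` as an algebraic identity, a form that can be transported to `B ⊗ K`.
-/
theorem exists_norm_sq_smul_sub_eq {E : Type*} [CStarAlgebra E] (T : E) :
    ∃ R : E, ((‖T‖ ^ 2 : ℝ) : ℂ) • 1 - star T * T = star R * R := by
  let _ := CStarAlgebra.spectralOrder E
  let _ := CStarAlgebra.spectralOrderedRing E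
  have h := CStarAlgebra.star_mul_le_algebraMap_norm_sq (a := T)
  rw [← sub_nonneg, CStarAlgebra.nonneg_iff_eq_star_mul_self] at h
  obtain ⟨R, hR⟩ := h
  refine ⟨R, ?_⟩
  rw [← hR, Algebra.algebraMap_eq_smul_one, Complex.coe_smul]

local notation "ℓ2" => lp (fun _ : ℕ => ℂ) 2

/-- Left multiplication of compact operators by a bounded operator. -/
def compactLeftMul (T : ℓ2 →L[ℂ] ℓ2) : CompactOps →ₗ[ℂ] CompactOps where
  toFun k := ⟨T * k, IsCompactOperator.clm_comp k.2 T⟩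
  map_add' k l := Subtype.ext (mul_add T k.1 l.1)
  map_smul' c k := Subtype.ext (mul_smul_comm c T k.1)

variable {B : Type*} [NonUnitalCStarAlgebra B]

variable (B) in
/-- The operator `1 ⊗ T` on the algebraic tensor product `B ⊗ K`. -/
def tensorAct (T : ℓ2 →L[ℂ] ℓ2) : (B ⊗[ℂ] CompactOps) →ₗ[ℂ] (B ⊗[ℂ] CompactOps) :=
  (compactLeftMul T).lTensor B

theorem tensorAct_tmul (T : ℓ2 →L[ℂ] ℓ2) (b : B) (k : CompactOps) :
    tensorAct B T (b ⊗ₜ k) = b ⊗ₜ compactLeftMul T k := rfl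

theorem tensorAct_one (x : B ⊗[ℂ] CompactOps) : tensorAct B 1 x = x := by
  have : compactLeftMul 1 = LinearMap.id := LinearMap.ext fun k => Subtype.ext (one_mul k.1)
  rw [tensorAct, this, LinearMap.lTensor_id, LinearMap.id_apply]

theorem tensorAct_mul (S T : ℓ2 →L[ℂ] ℓ2) (x : B ⊗[ℂ] CompactOps) :
    tensorAct B (S * T) x = tensorAct B S (tensorAct B T x) := by
  have : compactLeftMul (S * T) = compactLeftMul S ∘ₗ compactLeftMul T :=
    LinearMap.ext fun k => Subtype.ext (mul_assoc S T k.1)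
  rw [tensorAct, this, LinearMap.lTensor_comp, LinearMap.comp_apply]
  rfl

theorem tensorAct_sub (S T : ℓ2 →L[ℂ] ℓ2) (x : B ⊗[ℂ] CompactOps) :
    tensorAct B (S - T) x = tensorAct B S x - tensorAct B T x := by
  have : compactLeftMul (S - T) = compactLeftMul S - compactLeftMul T :=
    LinearMap.ext fun k => Subtype.ext (sub_mul S T k.1)
  rw [tensorAct, this, LinearMap.lTensor_sub, LinearMap.sub_apply]
  rfl

theorem tensorAct_smul (c : ℂ) (T : ℓ2 →L[ℂ] ℓ2) (x : B ⊗[ℂ] CompactOps) :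
    tensorAct B (c • T) x = c • tensorAct B T x := by
  have : compactLeftMul (c • T) = c • compactLeftMul T :=
    LinearMap.ext fun k => Subtype.ext (smul_mul_assoc c T k.1)
  rw [tensorAct, this, LinearMap.lTensor_smul, LinearMap.smul_apply]
  rfl

theorem star_tensorAct_mul (T : ℓ2 →L[ℂ] ℓ2) (x y : B ⊗[ℂ] CompactOps) :
    star (tensorAct B T x) * y = star x * tensorAct B (star T) y :=
  star_lTensor_mul (fun k l => Subtype.ext <| by
    change star (T * k.1) * l.1 = star k.1 * (star T * l.1)
    rw [star_mul, mul_assoc]) x y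

/-- Writing `‖T‖² - T⋆T = R⋆R` gives `‖T‖² x⋆x - (Tx)⋆(Tx) = (Rx)⋆(Rx)`, with `T`, `R` acting as `1
⊗ T`, `1 ⊗ R`. Applying `j` yields an inequality of positive elements of `B`. This bound lets `1 ⊗
T` extend to the completion. -/
theorem norm_map_tensorAct_le (j : (B ⊗[ℂ] CompactOps) →⋆ₙₐ[ℂ] B) (T : ℓ2 →L[ℂ] ℓ2)
    (x : B ⊗[ℂ] CompactOps) : ‖j (tensorAct B T x)‖ ≤ ‖T‖ * ‖j x‖ := by
  obtain ⟨R, hR⟩ := exists_norm_sq_smul_sub_eq T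
  have h1 : ((‖T‖ ^ 2 : ℝ) : ℂ) • (star (j x) * j x) - star (j (tensorAct B T x)) *
      j (tensorAct B T x) = star (j (tensorAct B R x)) * j (tensorAct B R x) := by
    simp only [← map_star, ← map_mul, star_tensorAct_mul, ← tensorAct_mul, ← hR, tensorAct_sub,
      tensorAct_smul, tensorAct_one, mul_sub, mul_smul_comm, map_sub, map_smul]
  let _ := CStarAlgebra.spectralOrder B
  let _ := CStarAlgebra.spectralOrderedRing B
  have h2 : star (j (tensorAct B T x)) * j (tensorAct B T x) ≤
      ((‖T‖ ^ 2 : ℝ) : ℂ) • (star (j x) * j x) := by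
    rw [← sub_nonneg, h1]
    exact star_mul_self_nonneg _
  have h3 := CStarAlgebra.norm_le_norm_of_nonneg_of_le (star_mul_self_nonneg _) h2
  rw [norm_smul, CStarRing.norm_star_mul_self, CStarRing.norm_star_mul_self] at h3
  refine le_of_sq_le_sq ?_ (by positivity)
  simp only [Complex.norm_real, norm_pow, norm_norm] at h3
  nlinarith

end Tensor

/-! ### Multipliers and strict limits -/

section Multipliers

variable {B : Type*} [NonUnitalCStarAlgebra B]

theorem eq_of_forall_mul_eq {a b : B} (h : ∀ d, d * a = d * b) : a = b := by
  have := h (star (a - b))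
  rw [← sub_eq_zero, ← mul_sub] at this
  exact sub_eq_zero.1 ((CStarRing.star_mul_self_eq_zero_iff _).1 this)

theorem eq_of_forall_eq_mul {a b : B} (h : ∀ d, a * d = b * d) : a = b := by
  have := h (star (a - b))
  rw [← sub_eq_zero, ← sub_mul] at this
  exact sub_eq_zero.1 ((CStarRing.mul_star_self_eq_zero_iff _).1 this)

theorem multiplier_ext {m n : 𝓜(ℂ, B)} (h : ∀ b, m.fst b = n.fst b) : m = n := by
  refine DoubleCentralizer.ext ℂ B m n (Prod.ext (ContinuousLinearMap.ext h)
    (ContinuousLinearMap.ext fun x => eq_of_forall_eq_mul fun y => ?_))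
  rw [m.central, n.central, h]

theorem multiplier_fst_mul (m : 𝓜(ℂ, B)) (x y : B) : m.fst (x * y) = m.fst x * y := by
  refine eq_of_forall_mul_eq fun d => ?_
  rw [← m.central, ← mul_assoc, ← mul_assoc, m.central]

/-- The adjoint relation `⟨d⋆, m⋆c⟩ = ⟨m d⋆, c⟩` for the `B`-valued form `⟨x, y⟩ = x⋆y`. -/
theorem mul_star_fst (m : 𝓜(ℂ, B)) (d c : B) : d * (star m).fst c = star (m.fst (star d)) * c := by
  rw [← (star m).central, DoubleCentralizer.star_snd]

/-- A strictly convergent sequence in `B` has a limit in `M(B)`. -/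
theorem exists_strict_limit {y : ℕ → B} (h1 : ∀ c, CauchySeq fun n => y n * c)
    (h2 : ∀ c, CauchySeq fun n => c * y n) : ∃ m : 𝓜(ℂ, B),
      (∀ c, Filter.Tendsto (fun n => y n * c) Filter.atTop (𝓝 (m.fst c))) ∧
      ∀ c, Filter.Tendsto (fun n => c * y n) Filter.atTop (𝓝 (m.snd c)) := by
  choose f hf using fun c => cauchySeq_tendsto_of_complete (h1 c)
  choose g hg using fun c => cauchySeq_tendsto_of_complete (h2 c)
  -- Boundedness of the pointwise limits comes from the Banach–Steinhaus theorem.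
  let F : B →L[ℂ] B := continuousLinearMapOfTendsto (fun n => ContinuousLinearMap.mul ℂ B (y n))
    (tendsto_pi_nhds.2 hf)
  let G : B →L[ℂ] B := continuousLinearMapOfTendsto
    (fun n => (ContinuousLinearMap.mul ℂ B).flip (y n)) (tendsto_pi_nhds.2 hg)
  refine ⟨⟨(F, G), fun x z => ?_⟩, hf, hg⟩
  change g x * z = x * f z
  refine tendsto_nhds_unique ((hg x).mul_const z) ?_
  simp_rw [mul_assoc]
  exact (hf z).const_mul x

/-- Strict limits are compatible with products of the form `b⋆na`. -/
theorem star_mul_mul_eq_of_tendsto {a b : ℕ → B} {m m' n g : 𝓜(ℂ, B)} {z : ℕ → B}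
    (ha : ∀ c, Filter.Tendsto (fun k => a k * c) Filter.atTop (𝓝 (m.fst c)))
    (hb : ∀ c, Filter.Tendsto (fun k => b k * c) Filter.atTop (𝓝 (m'.fst c)))
    (hz : ∀ k, z k = star (b k) * n.fst (a k))
    (hg : ∀ c, Filter.Tendsto (fun k => z k * c) Filter.atTop (𝓝 (g.fst c))) :
    star m' * n * m = g := by
  refine multiplier_ext fun c => eq_of_forall_mul_eq fun d => ?_
  have h1 : (star m' * n * m).fst c = (star m').fst (n.fst (m.fst c)) := by
    simp [DoubleCentralizer.mul_fst]
  rw [h1, mul_star_fst]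
  have h2 := (hb (star d)).star.mul (((n.fst.continuous.tendsto _).comp (ha c)))
  refine tendsto_nhds_unique h2 (((hg c).const_mul d).congr fun k => ?_)
  rw [hz, Function.comp_apply, multiplier_fst_mul, star_mul, star_star]
  simp only [mul_assoc]

end Multipliers

/-! ### The multipliers `1 ⊗ T` of a stable algebra -/

section Stable

local notation "ℓ2" => lp (fun _ : ℕ => ℂ) 2

variable {B : Type*} [NonUnitalCStarAlgebra B]

/-- `1 ⊗ T` as a bounded operator on a C⋆-tensor product of `B` and `K`. -/
def tensorOp (j : (B ⊗[ℂ] CompactOps) →⋆ₙₐ[ℂ] B) (T : ℓ2 →L[ℂ] ℓ2) : B →L[ℂ] B :=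
  ((j : (B ⊗[ℂ] CompactOps) →ₗ[ℂ] B) ∘ₗ tensorAct B T).extendOfNorm
    (j : (B ⊗[ℂ] CompactOps) →ₗ[ℂ] B)

variable {j : (B ⊗[ℂ] CompactOps) →⋆ₙₐ[ℂ] B} (hj : DenseRange j)
include hj

theorem tensorOp_apply (T : ℓ2 →L[ℂ] ℓ2) (x : B ⊗[ℂ] CompactOps) :
    tensorOp j T (j x) = j (tensorAct B T x) :=
  LinearMap.extendOfNorm_eq (e := (j : (B ⊗[ℂ] CompactOps) →ₗ[ℂ] B)) hj
    ⟨‖T‖, norm_map_tensorAct_le j T⟩ x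

theorem norm_tensorOp_apply_le (T : ℓ2 →L[ℂ] ℓ2) (b : B) : ‖tensorOp j T b‖ ≤ ‖T‖ * ‖b‖ :=
  LinearMap.norm_extendOfNorm_apply_le (e := (j : (B ⊗[ℂ] CompactOps) →ₗ[ℂ] B)) hj ‖T‖
    (norm_map_tensorAct_le j T) b

theorem tensorOp_mul (S T : ℓ2 →L[ℂ] ℓ2) (b : B) :
    tensorOp j (S * T) b = tensorOp j S (tensorOp j T b) := by
  refine hj.induction_on (p := fun b => tensorOp j (S * T) b = tensorOp j S (tensorOp j T b)) b
    (isClosed_eq (by fun_prop) (by fun_prop)) fun x => ?_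
  simp only [tensorOp_apply hj, tensorAct_mul]

theorem tensorOp_one (b : B) : tensorOp j 1 b = b := by
  refine hj.induction_on (p := fun b => tensorOp j 1 b = b) b
    (isClosed_eq (by fun_prop) (by fun_prop)) fun x => ?_
  simp only [tensorOp_apply hj, tensorAct_one]

theorem tensorOp_zero (b : B) : tensorOp j 0 b = 0 := by
  simpa using norm_tensorOp_apply_le hj 0 b

theorem star_tensorOp_mul (T : ℓ2 →L[ℂ] ℓ2) (b c : B) :
    star (tensorOp j T b) * c = star b * tensorOp j (star T) c := by
  refine hj.induction_on₂ (p := fun b c => star (tensorOp j T b) * c =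
    star b * tensorOp j (star T) c) (isClosed_eq (by fun_prop) (by fun_prop)) (fun x y => ?_) b c
  simp only [tensorOp_apply hj, ← map_star, ← map_mul, star_tensorAct_mul]

theorem isClosed_setOf_tendsto_tensorOp {W : ℕ → ℓ2 →L[ℂ] ℓ2} (hW : ∀ n, ‖W n‖ ≤ 1) :
    IsClosed {b : B | Filter.Tendsto (fun n => tensorOp j (W n) b) Filter.atTop (𝓝 0)} := by
  refine isClosed_of_closure_subset fun b hb => Metric.tendsto_atTop.2 fun ε hε => ?_
  obtain ⟨c, hc, hbc⟩ := Metric.mem_closure_iff.1 hb (ε / 2) (by positivity)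
  obtain ⟨N, hN⟩ := Metric.tendsto_atTop.1 hc (ε / 2) (by positivity)
  refine ⟨N, fun n hn => ?_⟩
  have h1 := hN n hn
  rw [dist_zero_right] at h1 ⊢
  calc ‖tensorOp j (W n) b‖
      = ‖tensorOp j (W n) (b - c) + tensorOp j (W n) c‖ := by rw [map_sub, sub_add_cancel]
    _ ≤ ‖tensorOp j (W n) (b - c)‖ + ‖tensorOp j (W n) c‖ := norm_add_le _ _
    _ ≤ 1 * ‖b - c‖ + ‖tensorOp j (W n) c‖ := by
        gcongr
        exact (norm_tensorOp_apply_le hj _ _).trans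
          (mul_le_mul_of_nonneg_right (hW n) (norm_nonneg _))
    _ < ε := by
        rw [one_mul, ← dist_eq_norm]
        linarith

/-- On `(b ⊗ k)(c ⊗ l)` the operator `W n` acts as `1 ⊗ (W n k)` on the fixed element `bc ⊗ l`, and
`W n k → 0` in norm as `k` is compact. Using products means that the bound for `tensorOp` suffices,
with no cross-norm estimate for `j`. -/
theorem tendsto_tensorOp_map_mul {W : ℕ → ℓ2 →L[ℂ] ℓ2} (hW : ∀ n, ‖W n‖ ≤ 1)
    (h0 : ∀ ξ, Filter.Tendsto (fun n => W n ξ) Filter.atTop (𝓝 0)) (x y : B ⊗[ℂ] CompactOps) :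
    Filter.Tendsto (fun n => tensorOp j (W n) (j (x * y))) Filter.atTop (𝓝 0) := by
  induction x with
  | zero => simp only [zero_mul, map_zero, tendsto_const_nhds]
  | add x x' hx hx' => simpa only [add_mul, map_add, add_zero] using hx.add hx'
  | tmul b k =>
    induction y with
    | zero => simp only [mul_zero, map_zero, tendsto_const_nhds]
    | add y y' hy hy' => simpa only [mul_add, map_add, add_zero] using hy.add hy'
    | tmul c l =>
      have hk := tendsto_mul_of_isCompactOperator hW h0 k.2
      have e (n : ℕ) : tensorOp j (W n) (j (b ⊗ₜ k * c ⊗ₜ l)) =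
          tensorOp j (W n * k.1) (j ((b * c) ⊗ₜ l)) := by
        rw [tensorOp_mul hj, tensorOp_apply hj k.1, tensorAct_tmul,
          Algebra.TensorProduct.tmul_mul_tmul]
        rfl
      simp only [e]
      refine squeeze_zero_norm (fun n => norm_tensorOp_apply_le hj _ _) ?_
      have := hk.norm.mul_const ‖j ((b * c) ⊗ₜ l)‖
      rwa [norm_zero, zero_mul] at this

theorem tendsto_tensorOp {W : ℕ → ℓ2 →L[ℂ] ℓ2} (hW : ∀ n, ‖W n‖ ≤ 1)
    (h0 : ∀ ξ, Filter.Tendsto (fun n => W n ξ) Filter.atTop (𝓝 0))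
    (hB : DenseRange fun p : B × B => p.1 * p.2) (b : B) :
    Filter.Tendsto (fun n => tensorOp j (W n) b) Filter.atTop (𝓝 0) := by
  have hcl := isClosed_setOf_tendsto_tensorOp hj hW
  refine hcl.closure_subset_iff.2 (Set.range_subset_iff.2 fun p => ?_) (hB b)
  refine hj.induction_on₂ (p := fun c d => c * d ∈ {b : B | Filter.Tendsto
    (fun n => tensorOp j (W n) b) Filter.atTop (𝓝 0)})
    (hcl.preimage continuous_mul) (fun x y => ?_) p.1 p.2
  rw [← map_mul]
  exact tendsto_tensorOp_map_mul hj hW h0 x y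

/-- `1 ⊗ T` as a multiplier of a C⋆-tensor product of `B` and `K`. -/
def tensorMultiplier (T : ℓ2 →L[ℂ] ℓ2) : 𝓜(ℂ, B) where
  fst := tensorOp j T
  snd := (((starₗᵢ ℂ : B ≃ₗᵢ⋆[ℂ] B) : B →L⋆[ℂ] B).comp (tensorOp j (star T))).comp
    ((starₗᵢ ℂ : B ≃ₗᵢ⋆[ℂ] B) : B →L⋆[ℂ] B)
  central x y := by
    have := star_tensorOp_mul hj (star T) (star x) y
    rwa [star_star, star_star] at this

theorem tensorMultiplier_fst (T : ℓ2 →L[ℂ] ℓ2) (b : B) :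
    (tensorMultiplier hj T).fst b = tensorOp j T b := rfl

theorem star_tensorMultiplier_fst (T : ℓ2 →L[ℂ] ℓ2) (b : B) :
    (star (tensorMultiplier hj T)).fst b = tensorOp j (star T) b := by
  rw [DoubleCentralizer.star_fst]
  change star (star (tensorOp j (star T) (star (star b)))) = _
  rw [star_star, star_star]

omit hj in
theorem IsSigmaUnital.denseRange_mul (hB : IsSigmaUnital B) :
    DenseRange fun p : B × B => p.1 * p.2 := by
  obtain ⟨e, -, -, -, he⟩ := hB
  exact fun b => mem_closure_of_tendsto (he b).1 (Filter.Eventually.of_forall fun n => ⟨(e n, b), rfl⟩)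

omit hj in
/-- The multiplier algebra of a stable C⋆-algebra contains a sequence of isometries `S n` with
orthogonal ranges such that `(S n)⋆ * b → 0` for all `b`. -/
theorem IsStable.exists_multiplier_isometries (hs : IsStable B) (hσ : IsSigmaUnital B) :
    ∃ S : ℕ → 𝓜(ℂ, B), (∀ m n, star (S m) * S n = if m = n then 1 else 0) ∧
      ∀ b, Filter.Tendsto (fun n => (star (S n)).fst b) Filter.atTop (𝓝 0) := by
  obtain ⟨j, -, hj⟩ := hs
  obtain ⟨V, hV, hV0⟩ := exists_orthogonal_isometries
  have hVn (n : ℕ) : ‖star (V n)‖ ≤ 1 := by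
    have := CStarRing.norm_star_mul_self (x := V n)
    rw [hV, if_pos rfl] at this
    have h1 : ‖(1 : ℓ2 →L[ℂ] ℓ2)‖ ≤ 1 := ContinuousLinearMap.norm_id_le
    rw [ContinuousLinearMap.star_eq_adjoint, LinearIsometryEquiv.norm_map]
    nlinarith [norm_nonneg (V n)]
  refine ⟨fun n => tensorMultiplier hj (V n), fun m n => multiplier_ext fun b => ?_, fun b => ?_⟩
  · change (star (tensorMultiplier hj (V m))).fst ((tensorMultiplier hj (V n)).fst b) = _
    rw [star_tensorMultiplier_fst, tensorMultiplier_fst, ← tensorOp_mul hj, hV]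
    split_ifs
    · exact tensorOp_one hj b
    · exact tensorOp_zero hj b
  · simp only [star_tensorMultiplier_fst]
    exact tendsto_tensorOp hj hVn hV0 hσ.denseRange_mul b

end Stable

/-! ### Strictly convergent sums of isometries -/

section StrictSums

variable {B : Type*} [NonUnitalCStarAlgebra B]

/-- A σ-unital C⋆-algebra has an approximate unit of the form `∑ i < n, (x i)⋆ * x i`. -/
theorem IsSigmaUnital.exists_sum (hσ : IsSigmaUnital B) : ∃ x : ℕ → B,
    (∀ n, ‖∑ i ∈ Finset.range n, star (x i) * x i‖ ≤ 1) ∧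
    ∀ b, Filter.Tendsto (fun n => (∑ i ∈ Finset.range n, star (x i) * x i) * b)
        Filter.atTop (𝓝 b) ∧
      Filter.Tendsto (fun n => b * ∑ i ∈ Finset.range n, star (x i) * x i) Filter.atTop (𝓝 b) := by
  obtain ⟨e, hpos, hle, hinc, he⟩ := hσ
  choose y hy using hinc
  obtain ⟨y0, hy0⟩ := hpos 0
  -- The squares `(x i)⋆ x i` are `e 0, e 1 - e 0, e 2 - e 1, …`; the empty sum precedes `e 0`,
  -- whence the index shift below.
  let x : ℕ → B := fun n => Nat.casesOn n y0 y
  have hx (n : ℕ) : ∑ i ∈ Finset.range (n + 1), star (x i) * x i = e n := by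
    induction n with
    | zero => exact Finset.sum_range_one _ |>.trans hy0.symm
    | succ n ih =>
      rw [Finset.sum_range_succ, ih, show star (x (n + 1)) * x (n + 1) = e (n + 1) - e n from
        (hy n).symm]
      abel
  refine ⟨x, fun n => ?_, fun b => ⟨?_, ?_⟩⟩
  · cases n with
    | zero => simp
    | succ n => rw [hx]; exact hle n
  · refine (Filter.tendsto_add_atTop_iff_nat 1).1 ?_
    simp only [hx]
    exact (he b).1
  · refine (Filter.tendsto_add_atTop_iff_nat 1).1 ?_
    simp only [hx]
    exact (he b).2

/-- If the `y n` have orthogonal ranges, `∑ (y n)⋆ * y n` is an approximate unit and the `y n` are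
summable on the left against that approximate unit, then `∑ y n` converges strictly in `M(B)`. -/
theorem exists_strict_sum {x y : ℕ → B} (hx : ∀ n, ‖∑ i ∈ Finset.range n, star (x i) * x i‖ ≤ 1)
    (hx1 : ∀ b, Filter.Tendsto (fun n => (∑ i ∈ Finset.range n, star (x i) * x i) * b)
      Filter.atTop (𝓝 b))
    (hx2 : ∀ b, Filter.Tendsto (fun n => b * ∑ i ∈ Finset.range n, star (x i) * x i)
      Filter.atTop (𝓝 b))
    (hy : ∀ i k, star (y i) * y k = if i = k then star (x i) * x i else 0)
    (hs : ∀ p, Summable fun n => (∑ i ∈ Finset.range p, star (x i) * x i) * y n) :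
    ∃ m : 𝓜(ℂ, B), ∀ c,
      Filter.Tendsto (fun n => (∑ i ∈ Finset.range n, y i) * c) Filter.atTop (𝓝 (m.fst c)) := by
  set E : ℕ → B := fun n => ∑ i ∈ Finset.range n, star (x i) * x i with hE
  set a : ℕ → B := fun n => ∑ i ∈ Finset.range n, y i with ha
  have hsub {N n : ℕ} (h : N ≤ n) : star (a n - a N) * (a n - a N) = E n - E N := by
    simp only [ha, hE]
    rw [← Finset.sum_Ico_eq_sub _ h, ← Finset.sum_Ico_eq_sub _ h, star_sum, Finset.sum_mul]
    refine Finset.sum_congr rfl fun i hi => ?_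
    rw [Finset.mul_sum]
    simp only [hy]
    rw [Finset.sum_ite_eq, if_pos hi]
  have hbd {N n : ℕ} (h : N ≤ n) : ‖a n - a N‖ ≤ 2 := by
    have h1 := CStarRing.norm_star_mul_self (x := a n - a N)
    rw [hsub h] at h1
    have h2 := norm_sub_le (E n) (E N)
    have h3 := hx n
    have h4 := hx N
    nlinarith [norm_nonneg (a n - a N)]
  -- By `hsub`, `‖(a n - a N)c‖² = ‖c⋆(E n - E N)c‖`.
  have hc1 (c : B) : CauchySeq fun n => a n * c := by
    refine Metric.cauchySeq_iff'.2 fun ε hε => ?_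
    obtain ⟨N, hN⟩ := Metric.cauchySeq_iff'.1 (hx1 c).cauchySeq (ε ^ 2 / (‖c‖ + 1)) (by positivity)
    refine ⟨N, fun n hn => ?_⟩
    have h1 := hN n hn
    rw [dist_eq_norm, ← sub_mul] at h1 ⊢
    refine lt_of_pow_lt_pow_left₀ 2 hε.le ?_
    calc ‖(a n - a N) * c‖ ^ 2 = ‖star c * ((E n - E N) * c)‖ := by
          rw [sq, ← CStarRing.norm_star_mul_self, star_mul, mul_assoc, ← mul_assoc (star (_ - _)),
            hsub hn]
      _ ≤ ‖c‖ * ‖(E n - E N) * c‖ := by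
          rw [← norm_star c]
          exact norm_mul_le _ _
      _ ≤ (‖c‖ + 1) * ‖(E n - E N) * c‖ := by gcongr; linarith
      _ < (‖c‖ + 1) * (ε ^ 2 / (‖c‖ + 1)) := by gcongr
      _ = ε ^ 2 := by field_simp
  -- Orthogonality gives nothing on this side. Instead `c` is replaced by `c E p`, for which `hs`
  -- gives convergence, and the error is controlled by the uniform bound `hbd`.
  have hc2 (c : B) : CauchySeq fun n => c * a n := by
    refine Metric.cauchySeq_iff'.2 fun ε hε => ?_
    obtain ⟨p, hp⟩ := Metric.tendsto_atTop.1 (hx2 c) (ε / 4) (by positivity)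
    have hp := hp p le_rfl
    have h1 : CauchySeq fun n => c * (E p * a n) := by
      have := ((hs p).hasSum.tendsto_sum_nat.const_mul c).cauchySeq
      simpa only [ha, Finset.mul_sum] using this
    obtain ⟨N, hN⟩ := Metric.cauchySeq_iff'.1 h1 (ε / 2) (by positivity)
    refine ⟨N, fun n hn => ?_⟩
    have h2 := hN n hn
    rw [dist_eq_norm] at h2 hp ⊢
    calc ‖c * a n - c * a N‖
        = ‖(c * (E p * a n) - c * (E p * a N)) - (c * E p - c) * (a n - a N)‖ := by
          congr 1
          noncomm_ring
      _ ≤ ‖c * (E p * a n) - c * (E p * a N)‖ + ‖(c * E p - c) * (a n - a N)‖ := norm_sub_le _ _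
      _ ≤ ‖c * (E p * a n) - c * (E p * a N)‖ + ‖c * E p - c‖ * 2 := by
          gcongr
          exact (norm_mul_le _ _).trans (mul_le_mul_of_nonneg_left (hbd hn) (norm_nonneg _))
      _ < ε / 2 + ε / 4 * 2 := by gcongr
      _ = ε := by ring
  obtain ⟨m, hm, -⟩ := exists_strict_limit hc1 hc2
  exact ⟨m, hm⟩

/-- Let `S n` be isometries in `M(B)` with orthogonal ranges and `(S n)⋆ * b → 0` for all `b`. Given
sequences `x`, `e` in `B` and `m` in `M(B)`, there is a subsequence of `S` along which the elements
`e p * S n * x q` and, for `n ≠ n'`, `(S n * x p)⋆ * m * (S n' * x q)` are arbitrarily small. -/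
theorem exists_almost_orthogonal {S : ℕ → 𝓜(ℂ, B)}
    (hS0 : ∀ b, Filter.Tendsto (fun n => (star (S n)).fst b) Filter.atTop (𝓝 0))
    (m : 𝓜(ℂ, B)) (x e : ℕ → B) : ∃ i : ℕ → ℕ, StrictMono i ∧
      (∀ n, ∀ p ≤ n, ∀ q ≤ n, ‖e p * (S (i n)).fst (x q)‖ ≤ (1 / 4) ^ n) ∧
      (∀ n n', n < n' → ∀ p ≤ n', ∀ q ≤ n',
        ‖star ((S (i n)).fst (x p)) * m.fst ((S (i n')).fst (x q))‖ ≤ (1 / 4) ^ n' ∧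
        ‖star ((S (i n')).fst (x p)) * m.fst ((S (i n)).fst (x q))‖ ≤ (1 / 4) ^ n') := by
  -- `c (S i) x = ((S i)⋆ c⋆)⋆ x`, so the decay of `(S i)⋆` makes every such product small. Each
  -- stage imposes finitely many conditions of this kind, all met by large `i`.
  have hT (c : B) (q : ℕ) :
      Filter.Tendsto (fun i => ‖c * (S i).fst (x q)‖) Filter.atTop (𝓝 0) := by
    have h1 (i : ℕ) : c * (S i).fst (x q) = star ((star (S i)).fst (star c)) * x q := by
      rw [← mul_star_fst, star_star]
    simp only [h1]
    simpa using (((hS0 (star c)).star.mul_const (x q))).norm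
  have hev (c : B) (q : ℕ) (w : ℕ) :
      ∀ᶠ i in Filter.atTop, ‖c * (S i).fst (x q)‖ ≤ (1 / 4) ^ w :=
    ((hT c q).eventually (gt_mem_nhds (by positivity))).mono fun i hi => hi.le
  -- The recursion runs over pairs (stage, index). The stage strictly increases along the sequence,
  -- hence is at least the position, and the estimates at position `n` follow from those at its
  -- stage.
  obtain ⟨f, hf, hr⟩ := exists_seq_of_forall_finset_exists (α := ℕ × ℕ)
    (fun a => ∀ p ≤ a.1, ∀ q ≤ a.1, ‖e p * (S a.2).fst (x q)‖ ≤ (1 / 4) ^ a.1)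
    (fun a b => a.1 < b.1 ∧ a.2 < b.2 ∧ ∀ p ≤ b.1, ∀ q ≤ b.1,
        ‖star ((S a.2).fst (x p)) * m.fst ((S b.2).fst (x q))‖ ≤ (1 / 4) ^ b.1 ∧
        ‖star ((S b.2).fst (x p)) * m.fst ((S a.2).fst (x q))‖ ≤ (1 / 4) ^ b.1) (by
    intro s _
    set w : ℕ := s.sup Prod.fst + 1 with hw
    have h1 : ∀ᶠ i in Filter.atTop, ∀ p ≤ w, ∀ q ≤ w, ‖e p * (S i).fst (x q)‖ ≤ (1 / 4) ^ w := by
      refine (Filter.eventually_all_finite (Set.finite_Iic w)).2 ?_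
      intro p _
      refine (Filter.eventually_all_finite (Set.finite_Iic w)).2 ?_
      exact fun q _ => hev _ _ _
    have h2 : ∀ᶠ i in Filter.atTop, ∀ a ∈ s, a.2 < i ∧ ∀ p ≤ w, ∀ q ≤ w,
        ‖star ((S a.2).fst (x p)) * m.fst ((S i).fst (x q))‖ ≤ (1 / 4) ^ w ∧
        ‖star ((S i).fst (x p)) * m.fst ((S a.2).fst (x q))‖ ≤ (1 / 4) ^ w := by
      rw [Filter.eventually_all_finset]
      intro a _
      refine (Filter.eventually_gt_atTop a.2).and ?_
      refine (Filter.eventually_all_finite (Set.finite_Iic w)).2 ?_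
      intro p _
      refine (Filter.eventually_all_finite (Set.finite_Iic w)).2 ?_
      intro q _
      refine Filter.Eventually.and ?_ ?_
      · refine (hev (m.snd (star ((S a.2).fst (x p)))) q w).mono fun i hi => ?_
        rwa [← m.central]
      · refine (hev (star (m.fst ((S a.2).fst (x q)))) p w).mono fun i hi => ?_
        rwa [← norm_star, star_mul, star_star]
    obtain ⟨i, hi1, hi2⟩ := (h1.and h2).exists
    refine ⟨(w, i), hi1, fun a ha => ⟨?_, (hi2 a ha).1, (hi2 a ha).2⟩⟩
    exact Nat.lt_succ_of_le (Finset.le_sup (f := Prod.fst) ha))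
  have hmono : StrictMono fun n => (f n).1 := fun n n' h => (hr n n' h).1
  have hle (n : ℕ) : n ≤ (f n).1 := hmono.le_apply
  have hpow (n : ℕ) : (1 / 4 : ℝ) ^ (f n).1 ≤ (1 / 4) ^ n :=
    pow_le_pow_of_le_one (by norm_num) (by norm_num) (hle n)
  refine ⟨fun n => (f n).2, fun n n' h => (hr n n' h).2.1, fun n p hp q hq =>
    (hf n p (hp.trans (hle n)) q (hq.trans (hle n))).trans (hpow n), fun n n' h p hp q hq => ?_⟩
  have := (hr n n' h).2.2 p (hp.trans (hle n')) q (hq.trans (hle n'))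
  exact ⟨this.1.trans (hpow n'), this.2.trans (hpow n')⟩

/-- In the multiplier algebra of a σ-unital stable C⋆-algebra `B`, for each `m` there are isometries
`a`, `b` with `b⋆a = 0` and `b⋆ma ∈ B`. -/
theorem exists_isometries_star_mul_mul_mem (hσ : IsSigmaUnital B) (hs : IsStable B)
    (m : 𝓜(ℂ, B)) : ∃ a b : 𝓜(ℂ, B), star a * a = 1 ∧ star b * b = 1 ∧ star b * a = 0 ∧
      star b * m * a ∈ multiplierIdeal B := by
  obtain ⟨S, hS, hS0⟩ := hs.exists_multiplier_isometries hσ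
  obtain ⟨x, hx, hx12⟩ := hσ.exists_sum
  obtain ⟨i, hi, hie, him⟩ := exists_almost_orthogonal hS0 m x
    (fun n => ∑ i ∈ Finset.range n, star (x i) * x i)
  have hSS (p q s t : ℕ) : star ((S p).fst (x s)) * (S q).fst (x t) =
      if p = q then star (x s) * x t else 0 := by
    have h1 := mul_star_fst (S p) (star (x s)) ((S q).fst (x t))
    rw [star_star] at h1
    rw [← h1, show (star (S p)).fst ((S q).fst (x t)) = (star (S p) * S q).fst (x t) from rfl, hS]
    split_ifs
    · rfl
    · exact mul_zero _
  have hsum (k : ℕ → ℕ) (hk : ∀ n, n ≤ k n) (p : ℕ) : Summable fun n =>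
      (∑ i ∈ Finset.range p, star (x i) * x i) * (S (i (k n))).fst (x n) := by
    refine Summable.of_norm_bounded_eventually_nat
      (summable_geometric_of_lt_one (r := (1 / 4 : ℝ)) (by norm_num) (by norm_num)) ?_
    filter_upwards [Filter.eventually_ge_atTop p] with n hn
    exact (hie (k n) p (hn.trans (hk n)) n (hk n)).trans
      (pow_le_pow_of_le_one (by norm_num) (by norm_num) (hk n))
  have hlim (k : ℕ → ℕ) (hk : StrictMono k) := exists_strict_sum
    (y := fun n => (S (i (k n))).fst (x n)) hx (fun b => (hx12 b).1) (fun b => (hx12 b).2)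
    (fun s t => by
      rw [hSS]
      by_cases hst : s = t
      · subst hst; simp
      · rw [if_neg hst, if_neg fun h => hst (hk.injective (hi.injective h))])
    (hsum k fun n => hk.le_apply)
  -- Even positions of the subsequence build `a`, odd ones build `b`.
  have hk0 : StrictMono fun n : ℕ => 2 * n := fun _ _ h => by simp only; omega
  have hk1 : StrictMono fun n : ℕ => 2 * n + 1 := fun _ _ h => by simp only; omega
  have hone (k : ℕ → ℕ) (hk : StrictMono k) (a : 𝓜(ℂ, B)) (ha : ∀ c, Filter.Tendsto
      (fun n => (∑ s ∈ Finset.range n, (S (i (k s))).fst (x s)) * c) Filter.atTop (𝓝 (a.fst c))) :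
      star a * a = 1 := by
    have := star_mul_mul_eq_of_tendsto (n := 1) (g := 1) ha ha
      (z := fun n => ∑ i ∈ Finset.range n, star (x i) * x i) (fun n => ?_) (fun c => (hx12 c).1)
    · rwa [mul_one] at this
    · rw [DoubleCentralizer.one_fst, one_apply_eq_self, star_sum, Finset.sum_mul]
      refine Finset.sum_congr rfl fun s hs => ?_
      rw [Finset.mul_sum, Finset.sum_eq_single s]
      · rw [hSS, if_pos rfl]
      · intro t _ ht
        rw [hSS, if_neg fun h => ht (hk.injective (hi.injective h)).symm]
      · exact fun h => absurd hs h
  obtain ⟨a, ha⟩ := hlim _ hk0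
  obtain ⟨b, hb⟩ := hlim _ hk1
  refine ⟨a, b, hone _ hk0 a ha, hone _ hk1 b hb, ?_, ?_⟩
  · have := star_mul_mul_eq_of_tendsto (n := 1) (g := 0) ha hb (z := fun _ => 0) (fun n => ?_)
      (fun c => by simp)
    · rwa [mul_one] at this
    · rw [DoubleCentralizer.one_fst, one_apply_eq_self, star_sum, Finset.sum_mul]
      refine (Finset.sum_eq_zero fun s _ => ?_).symm
      rw [Finset.mul_sum]
      refine Finset.sum_eq_zero fun t _ => ?_
      rw [hSS, if_neg fun h => ?_]
      have := hi.injective h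
      omega
  · have hsm : Summable fun p : ℕ × ℕ => star ((S (i (2 * p.1 + 1))).fst (x p.1)) *
        m.fst ((S (i (2 * p.2))).fst (x p.2)) := by
      have hg := summable_geometric_of_lt_one (r := (1 / 2 : ℝ)) (by norm_num) (by norm_num)
      refine Summable.of_norm_bounded (hg.mul_of_nonneg hg (fun _ => by positivity)
        fun _ => by positivity) fun p => ?_
      -- `q` will be the larger of `2 p.1 + 1` and `2 p.2`. The bound `4⁻q` then splits into a
      -- product of two geometric terms.
      have hpow (q : ℕ) (hq : p.1 + p.2 ≤ 2 * q) :
          (1 / 4 : ℝ) ^ q ≤ (1 / 2) ^ p.1 * (1 / 2) ^ p.2 := by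
        rw [← pow_add, show (1 / 4 : ℝ) = (1 / 2) ^ 2 by norm_num, ← pow_mul]
        exact pow_le_pow_of_le_one (by norm_num) (by norm_num) hq
      rcases lt_or_ge (2 * p.1 + 1) (2 * p.2) with h | h
      · exact (him _ _ h p.1 (by omega) p.2 (by omega)).1.trans (hpow _ (by omega))
      · exact (him (2 * p.2) (2 * p.1 + 1) (by omega) p.1 (by omega) p.2 (by omega)).2.trans
          (hpow _ (by omega))
    -- The squares `range n × range n` are cofinal among the finite subsets of `ℕ × ℕ`, and the sums
    -- over them are the products `(b n)⋆ m (a n)` of partial sums.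
    have ht := hsm.hasSum.comp (Filter.tendsto_atTop_finset_of_monotone
      (f := fun n => Finset.range n ×ˢ Finset.range n)
      (fun n n' h => Finset.product_subset_product (Finset.range_mono h) (Finset.range_mono h))
      (fun p => ⟨max p.1 p.2 + 1, by simp⟩))
    refine ⟨_, (star_mul_mul_eq_of_tendsto (n := m) ha hb
      (g := DoubleCentralizer.coeHom (∑' p : ℕ × ℕ, star ((S (i (2 * p.1 + 1))).fst (x p.1)) *
        m.fst ((S (i (2 * p.2))).fst (x p.2))))
      (z := fun n => ∑ p ∈ Finset.range n ×ˢ Finset.range n,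
        star ((S (i (2 * p.1 + 1))).fst (x p.1)) * m.fst ((S (i (2 * p.2))).fst (x p.2)))
      (fun n => ?_) (fun c => ht.mul_const c)).symm⟩
    rw [Finset.sum_product, star_sum, Finset.sum_mul, map_sum]
    simp only [Finset.mul_sum]

end StrictSums

end

/-- Any lift `m` of `u` will do: the construction of `a` and `b` accepts arbitrary multipliers, so
`m` need not be unitary. -/
theorem mainTheorem11 {B : Type*} [NonUnitalCStarAlgebra B] (hσ : IsSigmaUnital B)
    (hs : IsStable B) : IsK1Injective (Corona B) := by
  refine isK1Injective_of_forall_exists fun u => ?_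
  obtain ⟨m, hm⟩ := Ideal.Quotient.mk_surjective (u : Corona B)
  obtain ⟨a, b, ha, hb, hba, hbma⟩ := exists_isometries_star_mul_mul_mem hσ hs m
  refine ⟨Ideal.Quotient.mk _ a, Ideal.Quotient.mk _ b, ?_, ?_, ?_, ?_⟩
  · rw [Corona.star_mk, ← map_mul, ha, map_one]
  · rw [Corona.star_mk, ← map_mul, hb, map_one]
  · rw [Corona.star_mk, ← map_mul, hba, map_zero]
  · rw [← hm, Corona.star_mk, ← mul_assoc, ← map_mul, ← map_mul]
    exact Ideal.Quotient.eq_zero_iff_mem.2 hbma
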